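/- Let $(M,g)$ and $(N,h)$ be smooth finite-dimensional Riemannian manifolds (without boundary), with Levi-Civita connections $\nabla$ and $\nabla^N$, let $m=\dim M$, and let $\varphi:M\to N$ be a smooth map. Let $\overline{\nabla}$ be the connection on $\varphi^{-1}TN$ induced by $\nabla^N$, let $R^N(U,V)=\nabla^N_U\nabla^N_V-\nabla^N_V\nabla^N_U-\nabla^N_{[U,V]}$ be the curvature tensor of $N$, and let $\{e_i\}_{i=1}^m$ denote a local orthonormal frame of $(M,g)$. Define the tension field, the rough Laplacian and the Jacobi operator on sections $V$ of $\varphi^{-1}TN$, and the tritension field by $$\tau(\varphi)=\sum_{i=1}^m\{\overline{\nabla}_{e_i}(d\varphi(e_i))-d\varphi(\nabla_{e_i}e_i)\},\qquad \overline{\Delta}V=-\sum_{i=1}^m\{\overline{\nabla}_{e_i}\overline{\nabla}_{e_i}V-\overline{\nabla}_{\nabla_{e_i}e_i}V\},$$ $$\mathcal{J}(V)=\overline{\Delta}V-\sum_{i=1}^mR^N(V,d\varphi(e_i))d\varphi(e_i),\qquad \tau_3(\varphi)=\mathcal{J}(\overline{\Delta}\tau(\varphi))-\sum_{i=1}^mR^N(\overline{\nabla}_{e_i}\tau(\varphi),\tau(\varphi))d\varphi(e_i);$$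 these do not depend on the choice of the frame. Assume that $(N,h)$ has constant sectional curvature $c\in\mathbb{R}$ and that $\varphi$ is an isometric immersion, i.e. $h(d\varphi(u),d\varphi(v))=g(u,v)$ for all $x\in M$ and $u,v\in T_xM$. Then, at every point of $M$ and for every orthonormal basis $\{e_j\}$ of the tangent space there, $$\tau_3(\varphi)=\overline{\Delta}^2\tau(\varphi)-\sum_{j=1}^mR^N(\overline{\Delta}\tau(\varphi),d\varphi(e_j))d\varphi(e_j)-c\,h(\tau(\varphi),\tau(\varphi))\,\tau(\varphi).$$ -/

import Mathlib

open Bundle Manifold VectorField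
open scoped ContDiff

namespace RiemGeom


noncomputable section

/-! ### The Levi-Civita connection -/

section LeviCivita

variable {E : Type*} [NormedAddCommGroup E] [NormedSpace ℝ E] [FiniteDimensional ℝ E]
  {H : Type*} [TopologicalSpace H] (I : ModelWithCorners ℝ E H)
  {M : Type*} [TopologicalSpace M] [ChartedSpace H M]

instance tangentSpace_finiteDimensional (x : M) : FiniteDimensional ℝ (TangentSpace I x) :=
  inferInstanceAs (FiniteDimensional ℝ E)

variable [IsManifold I ∞ M] [RiemannianBundle (fun x : M ↦ TangentSpace I x)]

/-- The right-hand side of the Koszul formula for `⟨∇_X Y, Z⟩`. -/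
def koszul (X Y Z : Π x : M, TangentSpace I x) (x : M) : ℝ :=
  (mvfderiv I (fun z ↦ inner ℝ (Y z) (Z z)) x (X x)
    + mvfderiv I (fun z ↦ inner ℝ (Z z) (X z)) x (Y x)
    - mvfderiv I (fun z ↦ inner ℝ (X z) (Y z)) x (Z x)
    + inner ℝ (mlieBracket I X Y x) (Z x)
    - inner ℝ (mlieBracket I X Z x) (Y x)
    - inner ℝ (mlieBracket I Y Z x) (X x)) / 2

variable [IsContMDiffRiemannianBundle I ∞ E (fun x : M ↦ TangentSpace I x)]
  {X Y Z : Π x : M, TangentSpace I x} {x : M}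

variable {I} in
theorem mdiffAt_inner (hX : MDiffAt (T% X) x) (hY : MDiffAt (T% Y) x) :
    MDiffAt (fun z ↦ inner ℝ (X z) (Y z)) x :=
  MDifferentiableAt.inner_bundle (F := E) (E := fun x : M ↦ TangentSpace I x) hX hY

theorem koszul_tensorial_left (hY : MDiffAt (T% Y) x) (hZ : MDiffAt (T% Z) x) :
    TensorialAt I E (fun X ↦ koszul I X Y Z x) x where
  smul {f X} hf hX := by
    have h1 := mvfderiv_fun_mul hf (mdiffAt_inner hZ hX)
    have h2 := mvfderiv_fun_mul hf (mdiffAt_inner hX hY)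
    simp [koszul, inner_smul_left, inner_smul_right, mlieBracket_smul_left hf hX, h1, h2,
      inner_add_left]
    rw [real_inner_comm (X x) (Z x)]
    ring
  add {X X'} hX hX' := by
    have h1 := mvfderiv_fun_add (mdiffAt_inner hZ hX) (mdiffAt_inner hZ hX')
    have h2 := mvfderiv_fun_add (mdiffAt_inner hX hY) (mdiffAt_inner hX' hY)
    simp [koszul, mlieBracket_add_left hX hX', h1, h2, inner_add_left, inner_add_right]
    ring

theorem koszul_tensorial_right (hX : MDiffAt (T% X) x) (hY : MDiffAt (T% Y) x) :
    TensorialAt I E (fun Z ↦ koszul I X Y Z x) x where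
  smul {f Z} hf hZ := by
    have h1 := mvfderiv_fun_mul hf (mdiffAt_inner hY hZ)
    have h2 := mvfderiv_fun_mul hf (mdiffAt_inner hZ hX)
    simp [koszul, inner_smul_left, inner_smul_right, mlieBracket_smul_right hf hZ, h1, h2,
      inner_add_left]
    rw [real_inner_comm (Y x) (Z x)]
    ring
  add {Z Z'} hZ hZ' := by
    have h1 := mvfderiv_fun_add (mdiffAt_inner hY hZ) (mdiffAt_inner hY hZ')
    have h2 := mvfderiv_fun_add (mdiffAt_inner hZ hX) (mdiffAt_inner hZ' hX)
    simp [koszul, mlieBracket_add_right hZ hZ', h1, h2, inner_add_left, inner_add_right]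
    ring

theorem koszul_add (hX : MDiffAt (T% X) x) {Y Y' : Π x : M, TangentSpace I x}
    (hY : MDiffAt (T% Y) x)  (hY' : MDiffAt (T% Y') x) (hZ : MDiffAt (T% Z) x) :
    koszul I X (Y + Y') Z x = koszul I X Y Z x + koszul I X Y' Z x := by
  have h1 := mvfderiv_fun_add (mdiffAt_inner hY hZ) (mdiffAt_inner hY' hZ)
  have h2 := mvfderiv_fun_add (mdiffAt_inner hX hY) (mdiffAt_inner hX hY')
  simp [koszul, mlieBracket_add_right hY hY', mlieBracket_add_left hY hY', h1, h2,
    inner_add_left, inner_add_right]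
  ring

theorem koszul_leibniz {f : M → ℝ} (hf : MDiffAt f x) (hX : MDiffAt (T% X) x)
    (hY : MDiffAt (T% Y) x) (hZ : MDiffAt (T% Z) x) :
    koszul I X (f • Y) Z x =
      f x * koszul I X Y Z x + mvfderiv I f x (X x) * inner ℝ (Y x) (Z x) := by
  have h1 := mvfderiv_fun_mul hf (mdiffAt_inner hY hZ)
  have h2 := mvfderiv_fun_mul hf (mdiffAt_inner hX hY)
  simp [koszul, inner_smul_left, inner_smul_right, mlieBracket_smul_right hf hY,
    mlieBracket_smul_left hf hY, h1, h2, inner_add_left]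
  rw [real_inner_comm (Y x) (X x)]
  ring

open Classical in
/-- `leviCivitaFun I Y x v` is `(∇_v Y)(x)`: the tangent vector whose inner product with `z` is given
by the Koszul formula, for any differentiable fields that extend `v` and `z`. Where `Y` is not
differentiable the value is `0`. -/
def leviCivitaFun (Y : Π x : M, TangentSpace I x) (x : M) :
    TangentSpace I x →L[ℝ] TangentSpace I x :=
  if hY : MDiffAt (T% Y) x then
    ∑ k, ((TensorialAt.mkHom₂ (fun X Z ↦ koszul I X Y Z x) x
        (fun _ hZ ↦ koszul_tensorial_left I hY hZ)
        (fun _ hX ↦ koszul_tensorial_right I hX hY)).flip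
          (stdOrthonormalBasis ℝ (TangentSpace I x) k)).smulRight
            (stdOrthonormalBasis ℝ (TangentSpace I x) k)
  else 0

theorem inner_leviCivitaFun (hX : MDiffAt (T% X) x) (hY : MDiffAt (T% Y) x)
    (hZ : MDiffAt (T% Z) x) :
    inner ℝ (leviCivitaFun I Y x (X x)) (Z x) = koszul I X Y Z x := by
  rw [← TensorialAt.mkHom₂_apply (Φ := fun X Z ↦ koszul I X Y Z x)
    (fun _ hZ ↦ koszul_tensorial_left I hY hZ)
    (fun _ hX ↦ koszul_tensorial_right I hX hY) hX hZ]
  rw [leviCivitaFun, dif_pos hY]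
  generalize TensorialAt.mkHom₂ (fun X Z ↦ koszul I X Y Z x) x
    (fun _ hZ ↦ koszul_tensorial_left I hY hZ)
    (fun _ hX ↦ koszul_tensorial_right I hX hY) = A
  conv_rhs => rw [← (stdOrthonormalBasis ℝ (TangentSpace I x)).sum_repr' (Z x)]
  simp [sum_inner, inner_smul_left, mul_comm]

theorem ext_inner_field {v w : TangentSpace I x}
    (h : ∀ Z : Π x : M, TangentSpace I x, MDiffAt (T% Z) x → inner ℝ v (Z x) = inner ℝ w (Z x)) :
    v = w := by
  refine ext_inner_right ℝ fun z ↦ ?_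
  simpa using h (FiberBundle.extend E z) (FiberBundle.mdifferentiableAt_extend ..)

variable (M) in
/-- The Levi-Civita connection: `leviCivita I M Y x v` is `(∇_v Y)(x)`. -/
def leviCivita : CovariantDerivative I E (fun x : M ↦ TangentSpace I x) where
  toFun := leviCivitaFun I
  isCovariantDerivativeOnUniv :=
    { add := by
        intro Y Y' x hY hY' _
        ext1 v
        refine ext_inner_field I fun Z hZ ↦ ?_
        have hX := FiberBundle.mdifferentiableAt_extend I E v
        have hYY := mdifferentiableAt_add_section hY hY'
        have := inner_leviCivitaFun I hX hYY hZ
        simpa [inner_add_left, koszul_add I hX hY hY' hZ, ← inner_leviCivitaFun I hX hY hZ,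
          ← inner_leviCivitaFun I hX hY' hZ] using this
      leibniz := by
        intro Y f x hY hf _
        ext1 v
        refine ext_inner_field I fun Z hZ ↦ ?_
        have hX := FiberBundle.mdifferentiableAt_extend I E v
        have hYY := hf.smul_section hY
        have := inner_leviCivitaFun I hX hYY hZ
        simpa [inner_add_left, inner_smul_left, koszul_leibniz I hf hX hY hZ,
          ← inner_leviCivitaFun I hX hY hZ] using this }

theorem torsion_leviCivita : (leviCivita I M).torsion = 0 := by
  rw [CovariantDerivative.torsion_eq_zero_iff]
  intro X Y x hX hY
  refine ext_inner_field I fun Z hZ ↦ ?_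
  rw [inner_sub_left]
  erw [inner_leviCivitaFun I hX hY hZ, inner_leviCivitaFun I hY hX hZ]
  simp only [koszul, real_inner_comm]
  rw [mlieBracket_swap_apply (V := Y) (W := X), inner_neg_right]
  ring

theorem isMetricCompatible_leviCivita : CovariantDerivative.IsMetricCompatible (F := E)
    (V := fun x : M ↦ TangentSpace I x) (leviCivita I M) := by
  rw [CovariantDerivative.isMetricCompatible_iff]
  intro x X Y Z hX hY hZ
  dsimp only
  rw [real_inner_comm _ (Y x)]
  erw [inner_leviCivitaFun I hX hY hZ, inner_leviCivitaFun I hX hZ hY]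
  simp only [koszul, real_inner_comm]
  rw [mlieBracket_swap_apply (V := Z) (W := Y), inner_neg_right]
  ring

end LeviCivita

/-! ### Curvature -/

section Curvature

variable {F : Type*} [NormedAddCommGroup F] [NormedSpace ℝ F] [FiniteDimensional ℝ F]
  {G : Type*} [TopologicalSpace G] (J : ModelWithCorners ℝ F G)
  {N : Type*} [TopologicalSpace N] [ChartedSpace G N] [IsManifold J ∞ N]
  [RiemannianBundle (fun y : N ↦ TangentSpace J y)]
  [IsContMDiffRiemannianBundle J ∞ F (fun y : N ↦ TangentSpace J y)]

/-- The curvature tensor `R(u, v)w = ∇_U ∇_V W - ∇_V ∇_U W - ∇_[U, V] W` at `y`, where `U`, `V`, `W`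
are the extensions of `u`, `v`, `w` with constant components in the chart at `y`. -/
def curvature {y : N} (u v w : TangentSpace J y) : TangentSpace J y :=
  let U : Π z : N, TangentSpace J z := FiberBundle.extend F u
  let V : Π z : N, TangentSpace J z := FiberBundle.extend F v
  let W : Π z : N, TangentSpace J z := FiberBundle.extend F w
  leviCivita J N (fun z ↦ leviCivita J N W z (V z)) y u
    - leviCivita J N (fun z ↦ leviCivita J N W z (U z)) y v
    - leviCivita J N W y (mlieBracket J U V y)

/-- The sectional curvature of the plane spanned by two linearly independent tangent vectors. -/
def sectionalCurvature {y : N} (u v : TangentSpace J y) : ℝ :=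
  inner ℝ (curvature J u v v) u / (inner ℝ u u * inner ℝ v v - inner ℝ u v ^ 2)

variable (N) in
/-- `N` has constant (sectional) curvature `c`. -/
def HasConstantCurvature (c : ℝ) : Prop :=
  ∀ (y : N) (u v : TangentSpace J y), LinearIndependent ℝ ![u, v] → sectionalCurvature J u v = c

end Curvature

/-! ### Smooth maps between Riemannian manifolds -/

section Maps

variable {E : Type*} [NormedAddCommGroup E] [NormedSpace ℝ E] [FiniteDimensional ℝ E]
  {H : Type*} [TopologicalSpace H] (I : ModelWithCorners ℝ E H)
  {M : Type*} [TopologicalSpace M] [ChartedSpace H M] [IsManifold I ∞ M]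
  [RiemannianBundle (fun x : M ↦ TangentSpace I x)]
  [IsContMDiffRiemannianBundle I ∞ E (fun x : M ↦ TangentSpace I x)]
  {F : Type*} [NormedAddCommGroup F] [NormedSpace ℝ F] [FiniteDimensional ℝ F]
  {G : Type*} [TopologicalSpace G] (J : ModelWithCorners ℝ F G)
  {N : Type*} [TopologicalSpace N] [ChartedSpace G N] [IsManifold J ∞ N]
  [RiemannianBundle (fun y : N ↦ TangentSpace J y)]
  [IsContMDiffRiemannianBundle J ∞ F (fun y : N ↦ TangentSpace J y)]

/-- A smooth map whose differential preserves inner products (hence is injective). -/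
structure IsIsometricImmersion (φ : M → N) : Prop where
  smooth : ContMDiff I J ∞ φ
  inner_eq : ∀ (x : M) (u v : TangentSpace I x),
    inner ℝ (mfderiv I J φ x u) (mfderiv I J φ x v) = inner ℝ u v

/-- The connection on `φ⁻¹TN` induced by the Levi-Civita connection of `N`:
`covAlong I J φ V x v` is `(∇̄_v V)(x)` for a section `V` of `φ⁻¹TN`. In the trivialization `t` of
`TN` given by the chart at `φ x`, with coordinate fields `∂_a` and `V = ∑ V^a (∂_a ∘ φ)`, it is
`∑ dV^a(v) ∂_a + ∑ V^a(x) ∇^N_{dφ(v)} ∂_a`; the second sum is `∇^N_{dφ(v)}` of the field with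
constant components that extends `V x`. -/
def covAlong (φ : M → N) (V : Π x : M, TangentSpace J (φ x)) (x : M) :
    TangentSpace I x →L[ℝ] TangentSpace J (φ x) :=
  let t := trivializationAt F (fun y : N ↦ TangentSpace J y) (φ x)
  t.symmL ℝ (φ x) ∘L mvfderiv I (fun z ↦ (t ⟨φ z, V z⟩).2) x
    + leviCivita J N (FiberBundle.extend F (V x)) (φ x) ∘L mfderiv I J φ x

/-- The second fundamental form `B(φ)(u, v) = ∇̄_u (dφ(Y)) - dφ(∇_u Y)`, where `Y` is the extension of
`v` with constant components in the chart at `x`. -/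
def secondFundamentalForm (φ : M → N) (x : M) (u v : TangentSpace I x) : TangentSpace J (φ x) :=
  let Y : Π z : M, TangentSpace I z := FiberBundle.extend E v
  covAlong I J φ (fun z ↦ mfderiv I J φ z (Y z)) x u - mfderiv I J φ x (leviCivita I M Y x u)

/-- The tension field `τ(φ) = ∑ B(φ)(e_i, e_i)`. -/
def tension (φ : M → N) (x : M) : TangentSpace J (φ x) :=
  let e := stdOrthonormalBasis ℝ (TangentSpace I x)
  ∑ i, secondFundamentalForm I J φ x (e i) (e i)

/-- The second covariant derivative `∇̄_u ∇̄_Y V - ∇̄_{∇_u Y} V` of a section `V` of `φ⁻¹TN`, where `Y`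
is the extension of `v` with constant components in the chart at `x`. -/
def secondCovAlong (φ : M → N) (V : Π x : M, TangentSpace J (φ x)) (x : M)
    (u v : TangentSpace I x) : TangentSpace J (φ x) :=
  let Y : Π z : M, TangentSpace I z := FiberBundle.extend E v
  covAlong I J φ (fun z ↦ covAlong I J φ V z (Y z)) x u
    - covAlong I J φ V x (leviCivita I M Y x u)

/-- The rough Laplacian `Δ̄V = -∑ (∇̄_{e_i} ∇̄_{e_i} V - ∇̄_{∇_{e_i} e_i} V)` on sections of `φ⁻¹TN`. -/
def roughLaplacian (φ : M → N) (V : Π x : M, TangentSpace J (φ x)) (x : M) :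
    TangentSpace J (φ x) :=
  let e := stdOrthonormalBasis ℝ (TangentSpace I x);
  -∑ i, secondCovAlong I J φ V x (e i) (e i)

/-- The Jacobi operator `J(V) = Δ̄V - ∑ R^N(V, dφ(e_i)) dφ(e_i)`. -/
def jacobiOperator (φ : M → N) (V : Π x : M, TangentSpace J (φ x)) (x : M) :
    TangentSpace J (φ x) :=
  let e := stdOrthonormalBasis ℝ (TangentSpace I x)
  roughLaplacian I J φ V x
    - ∑ i, curvature J (V x) (mfderiv I J φ x (e i)) (mfderiv I J φ x (e i))

/-- The tritension field `τ₃(φ) = J(Δ̄τ(φ)) - ∑ R^N(∇̄_{e_i} τ(φ), τ(φ)) dφ(e_i)`. -/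
def tritension (φ : M → N) (x : M) : TangentSpace J (φ x) :=
  let e := stdOrthonormalBasis ℝ (TangentSpace I x)
  jacobiOperator I J φ (roughLaplacian I J φ (tension I J φ)) x
    - ∑ i, curvature J (covAlong I J φ (tension I J φ) x (e i)) (tension I J φ x)
        (mfderiv I J φ x (e i))

end Maps

end

end RiemGeom

open RiemGeom

/-!
For an isometric immersion the second fundamental form `B(u, v) = (∇dφ)(u, v)` is normal:
compatibility of the two metrics makes `⟨B(u, v), dφ(w)⟩` skew in `v, w`, while `B` is symmetric.
Hence `τ = tr B` is orthogonal to the image of `dφ`, and differentiating `⟨τ, dφ(X)⟩ = 0` gives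
`⟨∇̄_u τ, dφ(u)⟩ = -⟨τ, B(u, u)⟩`. In constant curvature `R(u, v)w = c(⟨v, w⟩u - ⟨u, w⟩v)`, so
`∑ R(∇̄_{e_i} τ, τ)dφ(e_i) = c|τ|²τ`. The remaining curvature sum is the trace of a bilinear form,
so it may be computed in any orthonormal basis.

Smoothness of `τ`, needed to differentiate, comes from Gram–Schmidt frames; the calculus of `∇̄` is
reduced to that of `∇^N` by writing a section along `φ` as a combination of sections `W ∘ φ`.
-/

namespace RiemGeom

open Filter Topology

section Calculus

variable {E : Type*} [NormedAddCommGroup E] [NormedSpace ℝ E]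
  {H : Type*} [TopologicalSpace H] {I : ModelWithCorners ℝ E H}
  {M : Type*} [TopologicalSpace M] [ChartedSpace H M]
  {F : Type*} [NormedAddCommGroup F] [NormedSpace ℝ F]
  {G : Type*} [TopologicalSpace G] {J : ModelWithCorners ℝ F G}
  {N : Type*} [TopologicalSpace N] [ChartedSpace G N]

theorem mvfderiv_congr_of_eventuallyEq {f g : M → F} {x : M} (h : f =ᶠ[𝓝 x] g) :
    mvfderiv I f x = mvfderiv I g x := by
  ext v
  exact congr($(h.mfderiv_eq (I := I) (I' := 𝓘(ℝ, F))) v)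

theorem tendsto_extChartAt_nhdsWithin_range (x : M) :
    Tendsto (extChartAt I x) (𝓝 x) (𝓝[Set.range I] extChartAt I x x) :=
  tendsto_nhdsWithin_iff.2
    ⟨continuousAt_extChartAt x, .of_forall fun _ ↦ Set.mem_range_self _⟩

variable [IsManifold I ∞ M]

theorem eventually_mdifferentiableAt [IsManifold J ∞ N] {φ : M → N} {x : M}
    (hφ : CMDiffAt ∞ φ x) : ∀ᶠ z in 𝓝 x, MDiffAt φ z :=
  ((contMDiffAt_iff_contMDiffAt_nhds (by simp)).1 (hφ.of_le (m := 1) (by simp))).mono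
    fun _ h ↦ h.mdifferentiableAt one_ne_zero

theorem contMDiffAt_mfderiv_apply [IsManifold J ∞ N] {φ : M → N}
    {X : Π z : M, TangentSpace I z} {x : M} (hφ : CMDiffAt ∞ φ x) (hX : CMDiffAt ∞ (T% X) x) :
    CMDiffAt ∞ (fun z ↦ (⟨φ z, mfderiv I J φ z (X z)⟩ : TangentBundle J N)) x :=
  ContMDiffAt.clm_apply_of_inCoordinates (hφ.mfderiv_const (m := ∞) (by simp)) hX hφ

theorem contMDiffAt_mvfderiv_apply {f : M → F} {X : Π z : M, TangentSpace I z} {x : M}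
    (hf : CMDiffAt ∞ f x) (hX : CMDiffAt ∞ (T% X) x) :
    CMDiffAt ∞ (fun z ↦ mvfderiv I f z (X z)) x :=
  (contMDiff_snd_tangentBundle_modelSpace F 𝓘(ℝ, F)).contMDiffAt.comp x
    (contMDiffAt_mfderiv_apply hf hX)

theorem mem_baseSet_trivializationAt_tangent {x z : M} (hz : z ∈ (chartAt H x).source) :
    z ∈ (trivializationAt E (TangentSpace I) x).baseSet := by
  simpa using hz

theorem trivializationAt_snd_eq_mvfderiv {x z : M} (hz : z ∈ (chartAt H x).source)
    (w : TangentSpace I z) :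
    (trivializationAt E (TangentSpace I) x ⟨z, w⟩).2 = mvfderiv I (extChartAt I x) z w := by
  have h := congr($(TangentBundle.continuousLinearMapAt_trivializationAt (I := I) hz) w)
  rwa [Trivialization.continuousLinearMapAt_apply, Trivialization.linearMapAt_apply,
    if_pos (mem_baseSet_trivializationAt_tangent hz)] at h

theorem mvfderiv_extChartAt_extend {x z : M} (v : TangentSpace I x)
    (hz : z ∈ (chartAt H x).source) :
    mvfderiv I (extChartAt I x) z ((FiberBundle.extend E v : Π z : M, TangentSpace I z) z) =
      mvfderiv I (extChartAt I x) x v := by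
  rw [← trivializationAt_snd_eq_mvfderiv hz, FiberBundle.extend,
    Trivialization.apply_mk_symm _ (mem_baseSet_trivializationAt_tangent hz),
    trivializationAt_snd_eq_mvfderiv (mem_chart_source H x)]

/-- The vector field on `E` with constant value `v`. -/
def constField (v : E) : Π p : E, TangentSpace 𝓘(ℝ, E) p :=
  fun _ ↦ v

theorem extend_eq_mpullback {x z : M} (v : TangentSpace I x) (hz : z ∈ (chartAt H x).source) :
    (FiberBundle.extend E v : Π z : M, TangentSpace I z) z =
      mpullback I 𝓘(ℝ, E) (extChartAt I x) (constField (mvfderiv I (extChartAt I x) x v)) z := by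
  have hinv : (mfderiv I 𝓘(ℝ, E) (extChartAt I x) z).IsInvertible :=
    isInvertible_mfderiv_extChartAt (by simpa using hz)
  rw [mpullback_apply, constField, ← mvfderiv_extChartAt_extend v hz]
  exact (hinv.inverse_apply_self _).symm

theorem mlieBracket_constField (v w : E) :
    mlieBracket 𝓘(ℝ, E) (constField v) (constField w) = 0 := by
  rw [← mlieBracketWithin_univ, mlieBracketWithin_eq_lieBracketWithin]
  funext p
  change fderivWithin ℝ (fun _ ↦ w) Set.univ p v - fderivWithin ℝ (fun _ ↦ v) Set.univ p w = (0 : E)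
  simp

theorem mlieBracket_extend_eq_zero [CompleteSpace E] {x z : M} (v w : TangentSpace I x)
    (hz : z ∈ (chartAt H x).source) :
    mlieBracket I (FiberBundle.extend E v) (FiberBundle.extend E w) z = 0 := by
  have hpull (u : TangentSpace I x) : (FiberBundle.extend E u : Π z : M, TangentSpace I z) =ᶠ[𝓝 z]
      mpullback I 𝓘(ℝ, E) (extChartAt I x) (constField (mvfderiv I (extChartAt I x) x u)) :=
    eventually_of_mem ((chartAt H x).open_source.mem_nhds hz) fun y hy ↦ extend_eq_mpullback u hy
  have hconst (u : E) : MDiffAt (T% (constField u)) (extChartAt I x z) :=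
    ((contMDiffAt_vectorSpace_iff_contDiffAt (n := 1)).2 contDiffAt_const).mdifferentiableAt
      one_ne_zero
  have : IsManifold I (minSmoothness ℝ 3) M := by
    rw [minSmoothness_of_isRCLikeNormedField]
    infer_instance
  rw [(hpull v).mlieBracket_vectorField_eq (hpull w),
    ← mpullback_mlieBracket (n := 2) (hconst _) (hconst _) (contMDiffAt_extChartAt' hz) (by simp)]
  refine (congrArg (mfderiv I 𝓘(ℝ, E) (extChartAt I x) z).inverse
    (congrFun (mlieBracket_constField _ _) _)).trans ?_
  exact map_zero _

theorem mvfderiv_comp_extChartAt {g : E → F} {x z : M} (hz : z ∈ (chartAt H x).source)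
    (hg : DifferentiableWithinAt ℝ g (Set.range I) (extChartAt I x z)) (w : TangentSpace I z) :
    mvfderiv I (g ∘ extChartAt I x) z w =
      fderivWithin ℝ g (Set.range I) (extChartAt I x z) (mvfderiv I (extChartAt I x) z w) := by
  have hmaps : Set.univ ⊆ extChartAt I x ⁻¹' Set.range I := fun y _ ↦ Set.mem_range_self _
  have h := mfderivWithin_comp z hg.mdifferentiableWithinAt
    (mdifferentiableAt_extChartAt (I := I) hz).mdifferentiableWithinAt hmaps
    (uniqueMDiffWithinAt_univ I)
  rw [mfderivWithin_univ, mfderivWithin_univ, mfderivWithin_eq_fderivWithin] at h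
  exact congr($h w)

theorem mvfderiv_extend_eventuallyEq {f : M → F} {x : M} (hf : CMDiffAt ∞ f x)
    (v : TangentSpace I x) :
    (fun z ↦ mvfderiv I f z ((FiberBundle.extend E v : Π z : M, TangentSpace I z) z)) =ᶠ[𝓝 x]
      (fun p ↦ fderivWithin ℝ (f ∘ (extChartAt I x).symm) (Set.range I) p
        (mvfderiv I (extChartAt I x) x v)) ∘ extChartAt I x := by
  set g : E → F := f ∘ (extChartAt I x).symm with hg
  have hgx : ContDiffWithinAt ℝ 1 g (Set.range I) (extChartAt I x x) :=
    (contMDiffAt_iff.1 hf).2.of_le (by simp)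
  have hnhds := hgx.eventually (by simp)
  rw [Set.insert_eq_of_mem (show extChartAt I x x ∈ Set.range I from Set.mem_range_self _)] at hnhds
  have hgd := (tendsto_extChartAt_nhdsWithin_range x).eventually hnhds
  filter_upwards [hgd, (chartAt H x).open_source.mem_nhds (mem_chart_source H x)] with z hgz hz
  have hfg : f =ᶠ[𝓝 z] g ∘ extChartAt I x := by
    filter_upwards [(chartAt H x).open_source.mem_nhds hz] with y hy
    rw [hg, Function.comp_apply, Function.comp_apply,
      (extChartAt I x).left_inv (by simpa using hy)]
  rw [mvfderiv_congr_of_eventuallyEq hfg,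
    mvfderiv_comp_extChartAt hz (hgz.differentiableWithinAt one_ne_zero),
    mvfderiv_extChartAt_extend v hz, Function.comp_apply]

theorem mvfderiv_mvfderiv_extend_comm {f : M → F} {x : M} (hf : CMDiffAt ∞ f x)
    (u v : TangentSpace I x) :
    mvfderiv I (fun z ↦ mvfderiv I f z ((FiberBundle.extend E v : Π z : M, TangentSpace I z) z)) x u
      = mvfderiv I
        (fun z ↦ mvfderiv I f z ((FiberBundle.extend E u : Π z : M, TangentSpace I z) z)) x v := by
  set g : E → F := f ∘ (extChartAt I x).symm
  have hmem : extChartAt I x x ∈ Set.range I := Set.mem_range_self _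
  have hg : ContDiffWithinAt ℝ 2 g (Set.range I) (extChartAt I x x) :=
    (contMDiffAt_iff.1 hf).2.of_le ENat.LEInfty.out
  have hg' : DifferentiableWithinAt ℝ (fderivWithin ℝ g (Set.range I)) (Set.range I)
      (extChartAt I x x) :=
    (hg.fderivWithin_right (m := 1) I.uniqueDiffOn (by norm_num) hmem).differentiableWithinAt
      one_ne_zero
  have hsnd (w u : TangentSpace I x) :
      mvfderiv I
        (fun z ↦ mvfderiv I f z ((FiberBundle.extend E w : Π z : M, TangentSpace I z) z)) x u =
      fderivWithin ℝ (fderivWithin ℝ g (Set.range I)) (Set.range I) (extChartAt I x x)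
        (mvfderiv I (extChartAt I x) x u) (mvfderiv I (extChartAt I x) x w) := by
    rw [mvfderiv_congr_of_eventuallyEq (mvfderiv_extend_eventuallyEq hf w),
      mvfderiv_comp_extChartAt (mem_chart_source H x)
        (hg'.clm_apply (differentiableWithinAt_const _)),
      fderivWithin_clm_apply (I.uniqueDiffOn _ hmem) hg' (differentiableWithinAt_const _)]
    simp
  rw [hsnd, hsnd]
  exact hg.isSymmSndFDerivWithinAt (by simp) I.uniqueDiffOn
    (I.range_subset_closure_interior hmem) hmem _ _

end Calculus

section OrthonormalFrame

variable {EB : Type*} [NormedAddCommGroup EB] [NormedSpace ℝ EB]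
  {HB : Type*} [TopologicalSpace HB] {IB : ModelWithCorners ℝ EB HB} {n : WithTop ℕ∞}
  {B : Type*} [TopologicalSpace B] [ChartedSpace HB B]
  {F : Type*} [NormedAddCommGroup F] [NormedSpace ℝ F]
  {V : B → Type*} [TopologicalSpace (TotalSpace F V)] [∀ x, NormedAddCommGroup (V x)]
  [∀ x, InnerProductSpace ℝ (V x)] [FiberBundle F V] [VectorBundle ℝ F V]
  [IsContMDiffRiemannianBundle IB n F V]
  {ι : Type*} [LinearOrder ι] [LocallyFiniteOrderBot ι] [WellFoundedLT ι]
  {X : ι → Π x : B, V x} {x : B}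

open InnerProductSpace

theorem contMDiffAt_gramSchmidt (hX : ∀ i, CMDiffAt n (T% (X i)) x)
    (hli : LinearIndependent ℝ (X · x)) (i : ι) :
    CMDiffAt n (T% (fun z ↦ gramSchmidt ℝ (X · z) i)) x := by
  induction i using WellFoundedLT.induction with
  | ind i ih =>
    have hproj : CMDiffAt n (T% (fun z ↦ ∑ j ∈ Finset.Iio i,
        (inner ℝ (gramSchmidt ℝ (X · z) j) (X i z) /
          inner ℝ (gramSchmidt ℝ (X · z) j) (gramSchmidt ℝ (X · z) j)) •
            gramSchmidt ℝ (X · z) j)) x := by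
      refine .sum_section fun j hj ↦ ?_
      have hj' := ih j (Finset.mem_Iio.1 hj)
      exact ((hj'.inner_bundle (hX i)).div₀ (hj'.inner_bundle hj')
        (inner_self_ne_zero.2 (gramSchmidt_ne_zero j hli))).smul_section hj'
    refine ((hX i).sub_section hproj).congr_of_eventuallyEq (.of_forall fun z ↦ ?_)
    have h := gramSchmidt_def'' ℝ (X · z) i
    simp only [RCLike.ofReal_real_eq_id, id, ← real_inner_self_eq_norm_sq] at h
    exact congrArg (TotalSpace.mk' F z) (eq_sub_of_add_eq h.symm)

theorem contMDiffAt_gramSchmidtNormed (hX : ∀ i, CMDiffAt n (T% (X i)) x)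
    (hli : LinearIndependent ℝ (X · x)) (i : ι) :
    CMDiffAt n (T% (fun z ↦ gramSchmidtNormed ℝ (X · z) i)) x := by
  have hG := contMDiffAt_gramSchmidt hX hli i
  have hne := gramSchmidt_ne_zero i hli
  have hnorm : CMDiffAt n (fun z ↦ (√(inner ℝ (gramSchmidt ℝ (X · z) i)
      (gramSchmidt ℝ (X · z) i)))⁻¹) x := by
    refine ContMDiffAt.inv₀ ?_ ?_
    · exact (Real.contDiffAt_sqrt (inner_self_ne_zero.2 hne)).contMDiffAt.comp x
        (hG.inner_bundle hG)
    · rw [← norm_eq_sqrt_real_inner]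
      exact norm_ne_zero_iff.2 hne
  refine (hnorm.smul_section hG).congr_of_eventuallyEq (.of_forall fun z ↦ ?_)
  refine congrArg (TotalSpace.mk' F z) ?_
  rw [Pi.smul_apply', ← norm_eq_sqrt_real_inner]
  rfl

variable (IB n F V) in
theorem exists_contMDiffAt_orthonormalBasis [FiniteDimensional ℝ F]
    [ContMDiffVectorBundle n F V IB] (x : B) :
    ∃ e : Fin (Module.finrank ℝ F) → Π z : B, V z, (∀ i, CMDiffAt n (T% (e i)) x) ∧
      ∀ᶠ z in 𝓝 x, ∃ b : OrthonormalBasis (Fin (Module.finrank ℝ F)) ℝ (V z),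
        ∀ i, b i = e i z := by
  let t := trivializationAt F V x
  let X := t.localFrame (Module.finBasis ℝ F)
  have hframe := t.isLocalFrameOn_localFrame_baseSet IB n (Module.finBasis ℝ F)
  have hx : x ∈ t.baseSet := FiberBundle.mem_baseSet_trivializationAt' x
  refine ⟨fun i z ↦ gramSchmidtNormed ℝ (X · z) i, fun i ↦ contMDiffAt_gramSchmidtNormed
    (fun i ↦ hframe.contMDiffAt t.open_baseSet hx i) (hframe.linearIndependent hx) i, ?_⟩
  filter_upwards [t.open_baseSet.mem_nhds hx] with z hz
  have hortho := gramSchmidtNormed_orthonormal (𝕜 := ℝ) (hframe.linearIndependent hz)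
  have hspan : ⊤ ≤ Submodule.span ℝ (Set.range (gramSchmidtNormed ℝ (X · z))) := by
    rw [span_gramSchmidtNormed_range, span_gramSchmidt]
    exact hframe.generating hz
  exact ⟨OrthonormalBasis.mk hortho hspan,
    fun i ↦ congrFun (OrthonormalBasis.coe_mk hortho hspan) i⟩

end OrthonormalFrame

section LeviCivita

variable {E : Type*} [NormedAddCommGroup E] [NormedSpace ℝ E]
  {H : Type*} [TopologicalSpace H] {I : ModelWithCorners ℝ E H}
  {M : Type*} [TopologicalSpace M] [ChartedSpace H M] [IsManifold I ∞ M]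
  {X Y Z : Π x : M, TangentSpace I x} {x : M}

theorem contMDiffAt_mlieBracket [CompleteSpace E] (hX : CMDiffAt ∞ (T% X) x)
    (hY : CMDiffAt ∞ (T% Y) x) : CMDiffAt ∞ (T% (mlieBracket I X Y)) x := by
  have : IsManifold I (∞ + 1) M := by simpa using ‹IsManifold I ∞ M›
  have : IsManifold I (minSmoothness ℝ 2) M := by
    rw [minSmoothness_of_isRCLikeNormedField]
    infer_instance
  exact ContMDiffAt.mlieBracket_vectorField (m := ⊤) (n := ⊤) hX hY (by simp)

variable [RiemannianBundle (fun x : M ↦ TangentSpace I x)]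
  [IsContMDiffRiemannianBundle I ∞ E (fun x : M ↦ TangentSpace I x)]

theorem contMDiffAt_inner (hX : CMDiffAt ∞ (T% X) x) (hY : CMDiffAt ∞ (T% Y) x) :
    CMDiffAt ∞ (fun z ↦ inner ℝ (X z) (Y z)) x :=
  ContMDiffAt.inner_bundle (F := E) (E := fun x : M ↦ TangentSpace I x) hX hY

variable [FiniteDimensional ℝ E]

theorem contMDiffAt_koszul (hX : CMDiffAt ∞ (T% X) x) (hY : CMDiffAt ∞ (T% Y) x)
    (hZ : CMDiffAt ∞ (T% Z) x) : CMDiffAt ∞ (koszul I X Y Z) x := by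
  unfold koszul
  simp only [div_eq_mul_inv]
  exact ((contMDiffAt_mvfderiv_apply (contMDiffAt_inner hY hZ) hX).add
    (contMDiffAt_mvfderiv_apply (contMDiffAt_inner hZ hX) hY) |>.sub
    (contMDiffAt_mvfderiv_apply (contMDiffAt_inner hX hY) hZ) |>.add
    (contMDiffAt_inner (contMDiffAt_mlieBracket hX hY) hZ) |>.sub
    (contMDiffAt_inner (contMDiffAt_mlieBracket hX hZ) hY) |>.sub
    (contMDiffAt_inner (contMDiffAt_mlieBracket hY hZ) hX)).mul contMDiffAt_const

theorem contMDiffAt_leviCivita (hX : CMDiffAt ∞ (T% X) x) (hY : CMDiffAt ∞ (T% Y) x) :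
    CMDiffAt ∞ (T% (fun z ↦ leviCivita I M Y z (X z))) x := by
  obtain ⟨e, he, hbasis⟩ :=
    exists_contMDiffAt_orthonormalBasis I ∞ E (fun x : M ↦ TangentSpace I x) x
  have hsum : CMDiffAt ∞ (T% (fun z ↦ ∑ i, koszul I X Y (e i) z • e i z)) x :=
    .sum_section fun i _ ↦ (contMDiffAt_koszul hX hY (he i)).smul_section (he i)
  refine hsum.congr_of_eventuallyEq ?_
  filter_upwards [hbasis, eventually_mdifferentiableAt hX, eventually_mdifferentiableAt hY,
    eventually_all.2 fun i ↦ eventually_mdifferentiableAt (he i)] with z ⟨b, hb⟩ hXz hYz hez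
  congr 1
  rw [← b.sum_repr' (leviCivita I M Y z (X z))]
  refine Finset.sum_congr rfl fun i _ ↦ ?_
  rw [hb i, ← inner_leviCivitaFun I hXz hYz (hez i), real_inner_comm]
  rfl

end LeviCivita

section IsCurvatureLike

/-- The algebraic symmetries of a `(0, 4)` curvature tensor `(u, v, w, z) ↦ ⟨R(u, v)w, z⟩`.
Linearity is encoded as additivity in the first and third slots; skew-symmetry transfers it to the
other two. -/
structure IsCurvatureLike {V : Type*} [AddCommGroup V] (T : V → V → V → V → ℝ) : Prop where
  add_fst : ∀ u u' v w z, T (u + u') v w z = T u v w z + T u' v w z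
  add_thd : ∀ u v w w' z, T u v (w + w') z = T u v w z + T u v w' z
  skew_left : ∀ u v w z, T u v w z = -T v u w z
  skew_right : ∀ u v w z, T u v w z = -T u v z w
  bianchi : ∀ u v w z, T u v w z + T v w u z + T w u v z = 0

namespace IsCurvatureLike

variable {V : Type*} [AddCommGroup V] {S T : V → V → V → V → ℝ}

theorem add_snd (hT : IsCurvatureLike T) (u v v' w z : V) :
    T u (v + v') w z = T u v w z + T u v' w z := by
  rw [hT.skew_left, hT.add_fst, hT.skew_left v u, hT.skew_left v' u]
  ring

theorem add_fth (hT : IsCurvatureLike T) (u v w z z' : V) :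
    T u v w (z + z') = T u v w z + T u v w z' := by
  rw [hT.skew_right, hT.add_thd, hT.skew_right u v z, hT.skew_right u v z']
  ring

theorem pair_symm (hT : IsCurvatureLike T) (u v w z : V) : T u v w z = T w z u v := by
  linarith [hT.bianchi v w u z, hT.bianchi w u z v, hT.bianchi u z v w, hT.bianchi z v w u,
    hT.skew_right v w u z, hT.skew_right w u v z, hT.skew_right u z w v, hT.skew_right z v u w,
    hT.skew_left v u z w, hT.skew_right u v w z, hT.skew_left z w u v, hT.skew_right w z v u]

theorem polarization (hT : IsCurvatureLike T) (hsect : ∀ u v, T u v v u = 0) (u v w : V) :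
    T u v v w = 0 := by
  have h := hsect (u + w) v
  rw [hT.add_fst, hT.add_fth, hT.add_fth, hsect, hsect, hT.pair_symm w v v u, hT.skew_left v u,
    hT.skew_right u v w v] at h
  linarith

theorem eq_zero (hT : IsCurvatureLike T) (hsect : ∀ u v, T u v v u = 0) (u v w z : V) :
    T u v w z = 0 := by
  have skew_mid (u v w z : V) : T u v w z = -T u w v z := by
    have h := hT.polarization hsect u (v + w) z
    rw [hT.add_snd, hT.add_thd, hT.add_thd, hT.polarization hsect, hT.polarization hsect] at h
    linarith
  linarith [hT.bianchi u v w z, skew_mid v w u z, hT.skew_left v u w z, hT.skew_left w u v z,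
    skew_mid u w v z]

theorem sub (hS : IsCurvatureLike S) (hT : IsCurvatureLike T) :
    IsCurvatureLike fun u v w z ↦ S u v w z - T u v w z where
  add_fst u u' v w z := by linarith [hS.add_fst u u' v w z, hT.add_fst u u' v w z]
  add_thd u v w w' z := by linarith [hS.add_thd u v w w' z, hT.add_thd u v w w' z]
  skew_left u v w z := by linarith [hS.skew_left u v w z, hT.skew_left u v w z]
  skew_right u v w z := by linarith [hS.skew_right u v w z, hT.skew_right u v w z]
  bianchi u v w z := by linarith [hS.bianchi u v w z, hT.bianchi u v w z]

theorem eq_of_sectional (hS : IsCurvatureLike S) (hT : IsCurvatureLike T)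
    (h : ∀ u v, S u v v u = T u v v u) (u v w z : V) : S u v w z = T u v w z :=
  sub_eq_zero.1 ((hS.sub hT).eq_zero (fun u v ↦ sub_eq_zero.2 (h u v)) u v w z)

end IsCurvatureLike

theorem isCurvatureLike_constant {V : Type*} [NormedAddCommGroup V] [InnerProductSpace ℝ V]
    (c : ℝ) : IsCurvatureLike fun u v w z : V ↦
      c * (inner ℝ v w * inner ℝ u z - inner ℝ u w * inner ℝ v z) where
  add_fst u u' v w z := by
    simp only [inner_add_left]
    ring
  add_thd u v w w' z := by
    simp only [inner_add_right]
    ring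
  skew_left u v w z := by ring
  skew_right u v w z := by ring
  bianchi u v w z := by
    rw [real_inner_comm u w, real_inner_comm v w, real_inner_comm u v]
    ring

end IsCurvatureLike

section Extend

variable {𝕜 : Type*} [NontriviallyNormedField 𝕜] {B : Type*} [TopologicalSpace B]
  {F : Type*} [NormedAddCommGroup F] [NormedSpace 𝕜 F]
  {V : B → Type*} [TopologicalSpace (TotalSpace F V)] [∀ x, AddCommGroup (V x)]
  [∀ x, Module 𝕜 (V x)] [∀ x, TopologicalSpace (V x)] [FiberBundle F V] [VectorBundle 𝕜 F V]

variable (𝕜 F) in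
theorem isLinearMap_extend_apply {x z : B} (hz : z ∈ (trivializationAt F V x).baseSet) :
    IsLinearMap 𝕜 fun v : V x ↦ FiberBundle.extend F v z := by
  convert ((trivializationAt F V x).symmₗ 𝕜 z ∘ₗ
    (trivializationAt F V x).linearMapAt 𝕜 x).isLinear with v
  rw [LinearMap.comp_apply, Trivialization.linearMapAt_apply,
    if_pos (FiberBundle.mem_baseSet_trivializationAt' x), Trivialization.coe_symmₗ _ hz]
  rfl

end Extend

section Curvature

variable {F : Type*} [NormedAddCommGroup F] [NormedSpace ℝ F]
  {G : Type*} [TopologicalSpace G] {J : ModelWithCorners ℝ F G}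
  {N : Type*} [TopologicalSpace N] [ChartedSpace G N] [IsManifold J ∞ N] {y : N}

/-- The extension of a tangent vector with constant components in the chart. -/
noncomputable abbrev extendField (u : TangentSpace J y) : Π z : N, TangentSpace J z :=
  FiberBundle.extend F u

theorem extendField_apply_self (u : TangentSpace J y) : extendField u y = u :=
  FiberBundle.extend_apply_self F u

theorem eventually_isLinearMap_extendField (y : N) :
    ∀ᶠ z in 𝓝 y, IsLinearMap ℝ fun u : TangentSpace J y ↦ extendField u z :=
  eventually_of_mem ((trivializationAt F (TangentSpace J) y).open_baseSet.mem_nhds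
    (FiberBundle.mem_baseSet_trivializationAt' y)) fun _ hz ↦ isLinearMap_extend_apply ℝ F hz

theorem extendField_add (u v : TangentSpace J y) :
    extendField (u + v) =ᶠ[𝓝 y] extendField u + extendField v :=
  (eventually_isLinearMap_extendField y).mono fun _ h ↦ h.map_add u v

theorem extendField_smul (a : ℝ) (u : TangentSpace J y) :
    extendField (a • u) =ᶠ[𝓝 y] a • extendField u :=
  (eventually_isLinearMap_extendField y).mono fun _ h ↦ h.map_smul a u

theorem contMDiffAt_extendField (u : TangentSpace J y) : CMDiffAt ∞ (T% (extendField u)) y :=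
  FiberBundle.contMDiffAt_extend J F u

theorem mdifferentiableAt_extendField (u : TangentSpace J y) : MDiffAt (T% (extendField u)) y :=
  FiberBundle.mdifferentiableAt_extend J F u

variable [FiniteDimensional ℝ F] [RiemannianBundle (fun y : N ↦ TangentSpace J y)]
  [IsContMDiffRiemannianBundle J ∞ F (fun y : N ↦ TangentSpace J y)]

section LeviCivitaRules

variable {X Y : Π z : N, TangentSpace J z}

theorem leviCivita_congr (hX : MDiffAt (T% X) y) (h : X =ᶠ[𝓝 y] Y) :
    leviCivita J N X y = leviCivita J N Y y :=
  (leviCivita J N).isCovariantDerivativeOnUniv.congr_of_eventuallyEq hX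
    (hX.congr_of_eventuallyEq (h.symm.mono fun z hz ↦ congrArg (TotalSpace.mk' F z) hz)) univ_mem h

theorem leviCivita_add (hX : MDiffAt (T% X) y) (hY : MDiffAt (T% Y) y) :
    leviCivita J N (X + Y) y = leviCivita J N X y + leviCivita J N Y y :=
  (leviCivita J N).isCovariantDerivativeOnUniv.add hX hY

theorem leviCivita_smul {f : N → ℝ} (hf : MDiffAt f y) (hX : MDiffAt (T% X) y)
    (v : TangentSpace J y) :
    leviCivita J N (f • X) y v = f y • leviCivita J N X y v + mvfderiv J f y v • X y := by
  rw [(leviCivita J N).isCovariantDerivativeOnUniv.leibniz hX hf]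
  rfl

theorem leviCivita_const_smul (a : ℝ) (hX : MDiffAt (T% X) y) :
    leviCivita J N (a • X) y = a • leviCivita J N X y :=
  (leviCivita J N).isCovariantDerivativeOnUniv.smul_const a hX

theorem mvfderiv_inner (hX : MDiffAt (T% X) y) (hY : MDiffAt (T% Y) y) (v : TangentSpace J y) :
    mvfderiv J (fun z ↦ inner ℝ (X z) (Y z)) y v =
      inner ℝ (leviCivita J N X y v) (Y y) + inner ℝ (X y) (leviCivita J N Y y v) := by
  have h := (isMetricCompatible_leviCivita J (M := N)).mvfderiv_inner_eq (extendField v) hX hY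
  simpa only [extendField_apply_self] using h

end LeviCivitaRules

/-- `covExtend v w` is the field `∇_V W`, where `V` and `W` extend `v` and `w` with constant
components. -/
noncomputable def covExtend (v w : TangentSpace J y) : Π z : N, TangentSpace J z :=
  fun z ↦ leviCivita J N (extendField w) z (extendField v z)

theorem covExtend_apply_self (v w : TangentSpace J y) :
    covExtend v w y = leviCivita J N (extendField w) y v := by
  rw [covExtend, extendField_apply_self]

theorem mdifferentiableAt_covExtend (v w : TangentSpace J y) : MDiffAt (T% (covExtend v w)) y :=
  (contMDiffAt_leviCivita (contMDiffAt_extendField v)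
    (contMDiffAt_extendField w)).mdifferentiableAt (by simp)

theorem covExtend_add_left (v v' w : TangentSpace J y) :
    covExtend (v + v') w =ᶠ[𝓝 y] covExtend v w + covExtend v' w := by
  filter_upwards [extendField_add v v'] with z hz
  rw [covExtend, hz]
  exact map_add _ _ _

theorem covExtend_smul_left (a : ℝ) (v w : TangentSpace J y) :
    covExtend (a • v) w =ᶠ[𝓝 y] a • covExtend v w := by
  filter_upwards [extendField_smul a v] with z hz
  rw [covExtend, hz]
  exact map_smul _ _ _

theorem covExtend_add_right (v w w' : TangentSpace J y) :
    covExtend v (w + w') =ᶠ[𝓝 y] covExtend v w + covExtend v w' := by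
  filter_upwards [eventually_mdifferentiableAt (contMDiffAt_extendField w),
    eventually_mdifferentiableAt (contMDiffAt_extendField w'),
    eventually_mdifferentiableAt (contMDiffAt_extendField (w + w')),
    (extendField_add w w').eventuallyEq_nhds] with z hz hz' hsum hadd
  rw [covExtend, leviCivita_congr hsum hadd, leviCivita_add hz hz']
  rfl

theorem covExtend_smul_right (a : ℝ) (v w : TangentSpace J y) :
    covExtend v (a • w) =ᶠ[𝓝 y] a • covExtend v w := by
  filter_upwards [eventually_mdifferentiableAt (contMDiffAt_extendField w),
    eventually_mdifferentiableAt (contMDiffAt_extendField (a • w)),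
    (extendField_smul a w).eventuallyEq_nhds] with z hz hmul hsmul
  rw [covExtend, leviCivita_congr hmul hsmul, leviCivita_const_smul a hz]
  rfl

theorem covExtend_comm (v w : TangentSpace J y) : covExtend v w =ᶠ[𝓝 y] covExtend w v := by
  filter_upwards [eventually_mdifferentiableAt (contMDiffAt_extendField v),
    eventually_mdifferentiableAt (contMDiffAt_extendField w),
    (chartAt G y).open_source.mem_nhds (mem_chart_source G y)] with z hv hw hz
  have h := (CovariantDerivative.torsion_eq_zero_iff _).1 (torsion_leviCivita J (M := N)) hv hw
  rw [mlieBracket_extend_eq_zero v w hz] at h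
  exact sub_eq_zero.1 h

theorem curvature_eq (u v w : TangentSpace J y) :
    curvature J u v w =
      leviCivita J N (covExtend v w) y u - leviCivita J N (covExtend u w) y v := by
  simp only [curvature, mlieBracket_extend_eq_zero u v (mem_chart_source G y), map_zero, sub_zero]
  rfl

theorem curvature_swap (u v w : TangentSpace J y) : curvature J u v w = -curvature J v u w := by
  rw [curvature_eq, curvature_eq, neg_sub]

theorem curvature_self (u w : TangentSpace J y) : curvature J u u w = 0 := by
  rw [curvature_eq, sub_self]

theorem curvature_add_left (u u' v w : TangentSpace J y) :
    curvature J (u + u') v w = curvature J u v w + curvature J u' v w := by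
  have h := leviCivita_congr (mdifferentiableAt_covExtend _ _) (covExtend_add_left u u' w)
  simp only [curvature_eq, h, map_add, add_apply, leviCivita_add
    (mdifferentiableAt_covExtend u w) (mdifferentiableAt_covExtend u' w)]
  abel

theorem curvature_smul_left (a : ℝ) (u v w : TangentSpace J y) :
    curvature J (a • u) v w = a • curvature J u v w := by
  have h := leviCivita_congr (mdifferentiableAt_covExtend _ _) (covExtend_smul_left a u w)
  simp only [curvature_eq, h, map_smul, smul_apply, smul_sub,
    leviCivita_const_smul a (mdifferentiableAt_covExtend u w)]

theorem curvature_add_middle (u v v' w : TangentSpace J y) :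
    curvature J u (v + v') w = curvature J u v w + curvature J u v' w := by
  rw [curvature_swap, curvature_add_left, neg_add, ← curvature_swap, ← curvature_swap]

theorem curvature_smul_middle (a : ℝ) (u v w : TangentSpace J y) :
    curvature J u (a • v) w = a • curvature J u v w := by
  rw [curvature_swap, curvature_smul_left, ← smul_neg, ← curvature_swap]

theorem curvature_add_right (u v w w' : TangentSpace J y) :
    curvature J u v (w + w') = curvature J u v w + curvature J u v w' := by
  have h (v : TangentSpace J y) : leviCivita J N (covExtend v (w + w')) y =
      leviCivita J N (covExtend v w) y + leviCivita J N (covExtend v w') y := by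
    rw [leviCivita_congr (mdifferentiableAt_covExtend _ _) (covExtend_add_right v w w'),
      leviCivita_add (mdifferentiableAt_covExtend v w) (mdifferentiableAt_covExtend v w')]
  simp only [curvature_eq, h, add_apply]
  abel

theorem curvature_smul_right (a : ℝ) (u v w : TangentSpace J y) :
    curvature J u v (a • w) = a • curvature J u v w := by
  have h (v : TangentSpace J y) :
      leviCivita J N (covExtend v (a • w)) y = a • leviCivita J N (covExtend v w) y := by
    rw [leviCivita_congr (mdifferentiableAt_covExtend _ _) (covExtend_smul_right a v w),
      leviCivita_const_smul a (mdifferentiableAt_covExtend v w)]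
  simp only [curvature_eq, h, smul_apply, smul_sub]

theorem curvature_bianchi (u v w : TangentSpace J y) :
    curvature J u v w + curvature J v w u + curvature J w u v = 0 := by
  have h (v w : TangentSpace J y) :=
    leviCivita_congr (mdifferentiableAt_covExtend v w) (covExtend_comm v w)
  rw [curvature_eq, curvature_eq, curvature_eq, h v w, h w u, h u v]
  abel

theorem mvfderiv_mvfderiv_inner_extendField_self (u v w : TangentSpace J y) :
    mvfderiv J (fun z ↦ mvfderiv J (fun z ↦ inner ℝ (extendField w z) (extendField w z)) z
      (extendField v z)) y u = 2 * (inner ℝ (leviCivita J N (covExtend v w) y u) w +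
        inner ℝ (covExtend v w y) (covExtend u w y)) := by
  have hfirst : (fun z ↦ mvfderiv J (fun z ↦ inner ℝ (extendField w z) (extendField w z)) z
      (extendField v z)) =ᶠ[𝓝 y] fun z ↦ 2 * inner ℝ (covExtend v w z) (extendField w z) := by
    filter_upwards [eventually_mdifferentiableAt (contMDiffAt_extendField w)] with z hz
    rw [mvfderiv_inner hz hz, real_inner_comm _ (extendField w z), covExtend]
    ring
  have hcov := mdifferentiableAt_covExtend v w
  have hw := mdifferentiableAt_extendField w
  rw [mvfderiv_congr_of_eventuallyEq hfirst,
    mvfderiv_fun_mul mdifferentiableAt_const (mdiffAt_inner hcov hw), mvfderiv_const, smul_zero,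
    add_zero, smul_apply, mvfderiv_inner hcov hw, extendField_apply_self,
    covExtend_apply_self u w, smul_eq_mul]

theorem inner_curvature_self (u v w : TangentSpace J y) :
    inner ℝ (curvature J u v w) w = 0 := by
  have h := mvfderiv_mvfderiv_extend_comm
    (contMDiffAt_inner (contMDiffAt_extendField w) (contMDiffAt_extendField w)) u v
  rw [mvfderiv_mvfderiv_inner_extendField_self, mvfderiv_mvfderiv_inner_extendField_self,
    real_inner_comm (covExtend u w y)] at h
  rw [curvature_eq, inner_sub_left]
  linarith

theorem inner_curvature_swap (u v w z : TangentSpace J y) :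
    inner ℝ (curvature J u v w) z = -inner ℝ (curvature J u v z) w := by
  have h := inner_curvature_self u v (w + z)
  rw [curvature_add_right, inner_add_left, inner_add_right, inner_add_right,
    inner_curvature_self, inner_curvature_self] at h
  linarith

variable (J) in
theorem isCurvatureLike_inner_curvature (y : N) :
    IsCurvatureLike fun u v w z : TangentSpace J y ↦ inner ℝ (curvature J u v w) z where
  add_fst u u' v w z := by rw [curvature_add_left, inner_add_left]
  add_thd u v w w' z := by rw [curvature_add_right, inner_add_left]
  skew_left u v w z := by rw [curvature_swap, inner_neg_left]
  skew_right := inner_curvature_swap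
  bianchi u v w z := by
    rw [← inner_add_left, ← inner_add_left, curvature_bianchi, inner_zero_left]

theorem curvature_eq_zero_of_not_linearIndependent {u v : TangentSpace J y}
    (h : ¬LinearIndependent ℝ ![u, v]) (w : TangentSpace J y) : curvature J u v w = 0 := by
  by_cases hu : u = 0
  · simpa [hu] using curvature_smul_left 0 (0 : TangentSpace J y) v w
  · rw [LinearIndependent.pair_iff' hu] at h
    push Not at h
    obtain ⟨a, rfl⟩ := h
    rw [curvature_smul_middle, curvature_self, smul_zero]

end Curvature

section ConstantCurvature

theorem gram_pair_ne_zero_iff {V : Type*} [NormedAddCommGroup V] [InnerProductSpace ℝ V]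
    {u v : V} :
    (inner ℝ u u * inner ℝ v v - inner ℝ u v ^ 2 : ℝ) ≠ 0 ↔ LinearIndependent ℝ ![u, v] := by
  rw [← Matrix.det_gram_ne_zero_iff_linearIndependent (𝕜 := ℝ), Matrix.det_fin_two]
  simp [Matrix.gram, real_inner_comm u v, sq]

variable {F : Type*} [NormedAddCommGroup F] [NormedSpace ℝ F] [FiniteDimensional ℝ F]
  {G : Type*} [TopologicalSpace G] {J : ModelWithCorners ℝ F G}
  {N : Type*} [TopologicalSpace N] [ChartedSpace G N] [IsManifold J ∞ N] {y : N}
  [RiemannianBundle (fun y : N ↦ TangentSpace J y)]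
  [IsContMDiffRiemannianBundle J ∞ F (fun y : N ↦ TangentSpace J y)] {c : ℝ}

theorem HasConstantCurvature.inner_curvature (hN : HasConstantCurvature J N c)
    (u v : TangentSpace J y) :
    inner ℝ (curvature J u v v) u = c * (inner ℝ u u * inner ℝ v v - inner ℝ u v ^ 2) := by
  by_cases hli : LinearIndependent ℝ ![u, v]
  · exact (div_eq_iff (gram_pair_ne_zero_iff.2 hli)).1 (hN y u v hli)
  · rw [curvature_eq_zero_of_not_linearIndependent hli, inner_zero_left,
      not_ne_iff.1 (gram_pair_ne_zero_iff.not.2 hli), mul_zero]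

theorem HasConstantCurvature.curvature_eq (hN : HasConstantCurvature J N c)
    (u v w : TangentSpace J y) :
    curvature J u v w = c • (inner ℝ v w • u - inner ℝ u w • v) := by
  refine ext_inner_right ℝ fun z ↦ ?_
  rw [real_inner_smul_left, inner_sub_left, real_inner_smul_left, real_inner_smul_left]
  refine (isCurvatureLike_inner_curvature J y).eq_of_sectional (isCurvatureLike_constant c)
    (fun u v ↦ ?_) u v w z
  rw [hN.inner_curvature, real_inner_comm u v]
  ring

end ConstantCurvature

section Trace

open InnerProductSpace TensorProduct in
theorem sum_orthonormalBasis_eq {T A ι κ : Type*} [NormedAddCommGroup T] [InnerProductSpace ℝ T]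
    [AddCommGroup A] [Module ℝ A] [Fintype ι] [Fintype κ] (B : T →ₗ[ℝ] T →ₗ[ℝ] A)
    (b : OrthonormalBasis ι ℝ T) (b' : OrthonormalBasis κ ℝ T) :
    ∑ i, B (b i) (b i) = ∑ j, B (b' j) (b' j) := by
  have := b.toBasis.finiteDimensional_of_finite
  have h := congr(TensorProduct.lift B $((canonicalCovariantTensor_eq_sum T b).symm.trans
    (canonicalCovariantTensor_eq_sum T b')))
  simpa only [map_sum, TensorProduct.lift.tmul] using h

variable {F : Type*} [NormedAddCommGroup F] [NormedSpace ℝ F] [FiniteDimensional ℝ F]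
  {G : Type*} [TopologicalSpace G] {J : ModelWithCorners ℝ F G}
  {N : Type*} [TopologicalSpace N] [ChartedSpace G N] [IsManifold J ∞ N]
  [RiemannianBundle (fun y : N ↦ TangentSpace J y)]
  [IsContMDiffRiemannianBundle J ∞ F (fun y : N ↦ TangentSpace J y)]

theorem sum_curvature_eq {T : Type*} [NormedAddCommGroup T] [InnerProductSpace ℝ T] {y : N}
    (A : T →ₗ[ℝ] TangentSpace J y) (w : TangentSpace J y) {ι κ : Type*} [Fintype ι] [Fintype κ]
    (b : OrthonormalBasis ι ℝ T) (b' : OrthonormalBasis κ ℝ T) :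
    ∑ i, curvature J w (A (b i)) (A (b i)) = ∑ j, curvature J w (A (b' j)) (A (b' j)) := by
  let R : TangentSpace J y →ₗ[ℝ] TangentSpace J y →ₗ[ℝ] TangentSpace J y :=
    LinearMap.mk₂ ℝ (curvature J w) (curvature_add_middle w) (curvature_smul_middle · w)
      (curvature_add_right w) (curvature_smul_right · w)
  exact sum_orthonormalBasis_eq (R.compl₁₂ A A) b b'

end Trace

section Along

variable {𝕜 : Type*} [NontriviallyNormedField 𝕜] {M N : Type*} [TopologicalSpace N]
  {F : Type*} [NormedAddCommGroup F] [NormedSpace 𝕜 F]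
  {V : N → Type*} [TopologicalSpace (TotalSpace F V)] [∀ y, TopologicalSpace (V y)]
  [FiberBundle F V] {φ : M → N} {s s' : Π z : M, V (φ z)} {x : M}

variable (F) in
/-- A section of the pullback bundle `φ⁻¹V`, as a map into the total space of `V`. -/
abbrev sectionAlong (φ : M → N) (s : Π z : M, V (φ z)) : M → TotalSpace F V :=
  fun z ↦ ⟨φ z, s z⟩

variable (F) in
/-- The components of a section of `φ⁻¹V` in the preferred trivialization of `V` at `φ x`. -/
def coordAlong (φ : M → N) (s : Π z : M, V (φ z)) (x z : M) : F :=
  (trivializationAt F V (φ x) ⟨φ z, s z⟩).2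

theorem symmL_coordAlong [∀ y, AddCommGroup (V y)] [∀ y, Module 𝕜 (V y)] [VectorBundle 𝕜 F V]
    {z : M} (hz : φ z ∈ (trivializationAt F V (φ x)).baseSet) :
    (trivializationAt F V (φ x)).symmL 𝕜 (φ z) (coordAlong F φ s x z) = s z := by
  rw [Trivialization.symmL_apply _ hz]
  exact Trivialization.symm_apply_apply_mk _ hz (s z)

variable {E : Type*} [NormedAddCommGroup E] [NormedSpace 𝕜 E]
  {H : Type*} [TopologicalSpace H] {I : ModelWithCorners 𝕜 E H}
  [TopologicalSpace M] [ChartedSpace H M]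
  {E' : Type*} [NormedAddCommGroup E'] [NormedSpace 𝕜 E']
  {G : Type*} [TopologicalSpace G] {J : ModelWithCorners 𝕜 E' G} [ChartedSpace G N] {n : ℕ∞ω}

theorem eventually_mem_baseSet (hφ : ContinuousAt φ x) :
    ∀ᶠ z in 𝓝 x, φ z ∈ (trivializationAt F V (φ x)).baseSet :=
  hφ.eventually <| (trivializationAt F V (φ x)).open_baseSet.mem_nhds
    (FiberBundle.mem_baseSet_trivializationAt F V (φ x))

theorem contMDiffAt_sectionAlong_comp {W : Π y : N, V y} (hφ : CMDiffAt n φ x)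
    (hW : CMDiffAt n (T% W) (φ x)) : CMDiffAt n (sectionAlong F φ fun z ↦ W (φ z)) x :=
  hW.comp x hφ

theorem mdifferentiableAt_sectionAlong_comp {W : Π y : N, V y} (hφ : MDiffAt φ x)
    (hW : MDiffAt (T% W) (φ x)) : MDiffAt (sectionAlong F φ fun z ↦ W (φ z)) x :=
  hW.comp x hφ

theorem mdifferentiableAt_sectionAlong_iff (hφ : MDiffAt φ x) :
    MDiffAt (sectionAlong F φ s) x ↔ MDiffAt (coordAlong F φ s x) x := by
  rw [mdifferentiableAt_totalSpace]
  exact and_iff_right hφ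

theorem contMDiffAt_sectionAlong_iff (hφ : CMDiffAt n φ x) :
    CMDiffAt n (sectionAlong F φ s) x ↔ CMDiffAt n (coordAlong F φ s x) x := by
  rw [contMDiffAt_totalSpace]
  exact and_iff_right hφ

variable [∀ y, AddCommGroup (V y)]

theorem coordAlong_extend (hφ : ContinuousAt φ x) (v : V (φ x)) :
    coordAlong F φ (fun z ↦ FiberBundle.extend F v (φ z)) x =ᶠ[𝓝 x]
      fun _ ↦ (trivializationAt F V (φ x) ⟨φ x, v⟩).2 := by
  filter_upwards [eventually_mem_baseSet (F := F) (V := V) hφ] with z hz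
  rw [coordAlong, FiberBundle.extend, Trivialization.apply_mk_symm _ hz]

variable [∀ y, Module 𝕜 (V y)]

variable (𝕜) in
theorem coordAlong_add [VectorBundle 𝕜 F V] (hφ : ContinuousAt φ x) :
    coordAlong F φ (s + s') x =ᶠ[𝓝 x] coordAlong F φ s x + coordAlong F φ s' x :=
  (eventually_mem_baseSet hφ).mono fun _ hz ↦
    ((trivializationAt F V (φ x)).linear 𝕜 hz).map_add _ _

variable [VectorBundle 𝕜 F V]

theorem coordAlong_smul (hφ : ContinuousAt φ x) (f : M → 𝕜) :
    coordAlong F φ (fun z ↦ f z • s z) x =ᶠ[𝓝 x] f • coordAlong F φ s x :=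
  (eventually_mem_baseSet hφ).mono fun _ hz ↦
    ((trivializationAt F V (φ x)).linear 𝕜 hz).map_smul _ _

theorem contMDiffAt_sectionAlong_add (hφ : CMDiffAt n φ x) (hs : CMDiffAt n (sectionAlong F φ s) x)
    (hs' : CMDiffAt n (sectionAlong F φ s') x) : CMDiffAt n (sectionAlong F φ (s + s')) x := by
  rw [contMDiffAt_sectionAlong_iff hφ] at *
  exact (hs.add hs').congr_of_eventuallyEq (coordAlong_add 𝕜 hφ.continuousAt)

theorem contMDiffAt_sectionAlong_smul (hφ : CMDiffAt n φ x) {f : M → 𝕜} (hf : CMDiffAt n f x)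
    (hs : CMDiffAt n (sectionAlong F φ s) x) :
    CMDiffAt n (sectionAlong F φ fun z ↦ f z • s z) x := by
  rw [contMDiffAt_sectionAlong_iff hφ] at *
  exact (hf.smul hs).congr_of_eventuallyEq (coordAlong_smul hφ.continuousAt f)

theorem contMDiffAt_sectionAlong_zero (hφ : CMDiffAt n φ x) :
    CMDiffAt n (sectionAlong F φ (0 : Π z : M, V (φ z))) x :=
  contMDiffAt_sectionAlong_comp hφ (contMDiff_zeroSection 𝕜 V).contMDiffAt

theorem contMDiffAt_sectionAlong_sum (hφ : CMDiffAt n φ x)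
    {ι : Type*} {σ : ι → Π z : M, V (φ z)} (t : Finset ι)
    (hσ : ∀ i ∈ t, CMDiffAt n (sectionAlong F φ (σ i)) x) :
    CMDiffAt n (sectionAlong F φ (∑ i ∈ t, σ i)) x :=
  Finset.sum_induction σ (fun s ↦ CMDiffAt n (sectionAlong F φ s) x)
    (fun _ _ ↦ contMDiffAt_sectionAlong_add hφ) (contMDiffAt_sectionAlong_zero hφ) hσ

/-- Near `x` a `C^n` section along `φ` is a combination, with `C^n` coefficients, of sections of the
form `W ∘ φ`. -/
theorem contMDiffAt_sectionAlong_induction [CompleteSpace 𝕜] [FiniteDimensional 𝕜 F]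
    [ContMDiffVectorBundle n F V J] (hφ : CMDiffAt n φ x) {P : (Π z : M, V (φ z)) → Prop}
    (congr : ∀ {s s' : Π z : M, V (φ z)}, (∀ᶠ z in 𝓝 x, s z = s' z) → P s → P s')
    (comp : ∀ {W : Π y : N, V y}, CMDiffAt n (T% W) (φ x) → P fun z ↦ W (φ z))
    (smul : ∀ {f : M → 𝕜} {s}, CMDiffAt n f x → CMDiffAt n (sectionAlong F φ s) x → P s →
      P fun z ↦ f z • s z)
    (add : ∀ {s s'}, CMDiffAt n (sectionAlong F φ s) x → CMDiffAt n (sectionAlong F φ s') x →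
      P s → P s' → P (s + s'))
    (hs : CMDiffAt n (sectionAlong F φ s) x) : P s := by
  let t := trivializationAt F V (φ x)
  let b := Module.finBasis 𝕜 F
  let coeff (i : Fin (Module.finrank 𝕜 F)) (z : M) : 𝕜 := b.repr (coordAlong F φ s x z) i
  let term (i : Fin (Module.finrank 𝕜 F)) (z : M) : V (φ z) := coeff i z • t.localFrame b i (φ z)
  have frame_smooth (i) : CMDiffAt n (T% (t.localFrame b i)) (φ x) :=
    contMDiffAt_localFrame_of_mem n t b i (FiberBundle.mem_baseSet_trivializationAt F V (φ x))
  have coeff_smooth (i) : CMDiffAt n (coeff i) x :=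
    (b.coord i).toContinuousLinearMap.contDiff.contDiffAt.contMDiffAt.comp x
      ((contMDiffAt_sectionAlong_iff hφ).1 hs)
  have frame_comp_smooth (i) := contMDiffAt_sectionAlong_comp hφ (frame_smooth i)
  have sum_term : ∀ᶠ z in 𝓝 x, (∑ i, term i) z = s z := by
    filter_upwards [eventually_mem_baseSet (F := F) (V := V) hφ.continuousAt] with z hz
    simp only [term, Finset.sum_apply, t.localFrame_apply_of_mem_baseSet b hz]
    exact (t.basisAt b hz).sum_repr (s z)
  refine congr sum_term (And.right (Finset.sum_induction term
    (fun s ↦ CMDiffAt n (sectionAlong F φ s) x ∧ P s)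
    (fun _ _ h h' ↦ ⟨contMDiffAt_sectionAlong_add hφ h.1 h'.1, add h.1 h'.1 h.2 h'.2⟩)
    ⟨contMDiffAt_sectionAlong_zero hφ, comp (contMDiff_zeroSection 𝕜 V).contMDiffAt⟩ fun i _ ↦
      ⟨contMDiffAt_sectionAlong_smul hφ (coeff_smooth i) (frame_comp_smooth i),
        smul (coeff_smooth i) (frame_comp_smooth i) (comp (frame_smooth i))⟩))

end Along

section CovAlong

variable {E : Type*} [NormedAddCommGroup E] [NormedSpace ℝ E]
  {H : Type*} [TopologicalSpace H] {I : ModelWithCorners ℝ E H}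
  {M : Type*} [TopologicalSpace M] [ChartedSpace H M]
  {F : Type*} [NormedAddCommGroup F] [NormedSpace ℝ F]
  {G : Type*} [TopologicalSpace G] {J : ModelWithCorners ℝ F G}
  {N : Type*} [TopologicalSpace N] [ChartedSpace G N] [IsManifold J ∞ N]
  [RiemannianBundle (fun y : N ↦ TangentSpace J y)]
  [IsContMDiffRiemannianBundle J ∞ F (fun y : N ↦ TangentSpace J y)]
  {φ : M → N} {V V' : Π z : M, TangentSpace J (φ z)} {x : M}

theorem mdifferentiableAt_inner_along (hV : MDiffAt (sectionAlong F φ V) x)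
    (hV' : MDiffAt (sectionAlong F φ V') x) : MDiffAt (fun z ↦ inner ℝ (V z) (V' z)) x :=
  MDifferentiableAt.inner_bundle (F := F) (E := fun y : N ↦ TangentSpace J y) hV hV'

variable [FiniteDimensional ℝ F]

theorem leviCivita_extendField_add {y : N} (u v : TangentSpace J y) :
    leviCivita J N (extendField (u + v)) y =
      leviCivita J N (extendField u) y + leviCivita J N (extendField v) y := by
  rw [leviCivita_congr (mdifferentiableAt_extendField _) (extendField_add u v),
    leviCivita_add (mdifferentiableAt_extendField u) (mdifferentiableAt_extendField v)]

theorem leviCivita_extendField_smul {y : N} (a : ℝ) (u : TangentSpace J y) :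
    leviCivita J N (extendField (a • u)) y = a • leviCivita J N (extendField u) y := by
  rw [leviCivita_congr (mdifferentiableAt_extendField _) (extendField_smul a u),
    leviCivita_const_smul a (mdifferentiableAt_extendField u)]

theorem covAlong_apply (v : TangentSpace I x) :
    covAlong I J φ V x v =
      (trivializationAt F (TangentSpace J) (φ x)).symmL ℝ (φ x)
          (mvfderiv I (coordAlong F φ V x) x v) +
        leviCivita J N (extendField (V x)) (φ x) (mfderiv I J φ x v) :=
  rfl

theorem covAlong_congr (h : ∀ᶠ z in 𝓝 x, V z = V' z) :
    covAlong I J φ V x = covAlong I J φ V' x := by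
  have hcoord : coordAlong F φ V x =ᶠ[𝓝 x] coordAlong F φ V' x :=
    h.mono fun z hz ↦ by simp only [coordAlong, hz]
  ext v
  rw [covAlong_apply, covAlong_apply, mvfderiv_congr_of_eventuallyEq hcoord, h.self_of_nhds]

theorem covAlong_add (hφ : MDiffAt φ x) (hV : MDiffAt (sectionAlong F φ V) x)
    (hV' : MDiffAt (sectionAlong F φ V') x) :
    covAlong I J φ (V + V') x = covAlong I J φ V x + covAlong I J φ V' x := by
  rw [mdifferentiableAt_sectionAlong_iff hφ] at hV hV'
  ext v
  rw [covAlong_apply, mvfderiv_congr_of_eventuallyEq (coordAlong_add ℝ hφ.continuousAt),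
    mvfderiv_add hV hV', Pi.add_apply, leviCivita_extendField_add, add_apply, add_apply,
    add_apply, map_add, covAlong_apply, covAlong_apply]
  abel

theorem covAlong_smul (hφ : MDiffAt φ x) {f : M → ℝ} (hf : MDiffAt f x)
    (hV : MDiffAt (sectionAlong F φ V) x) (v : TangentSpace I x) :
    covAlong I J φ (fun z ↦ f z • V z) x v =
      f x • covAlong I J φ V x v + mvfderiv I f x v • V x := by
  have hcoord : (trivializationAt F (TangentSpace J) (φ x)).symmL ℝ (φ x) (coordAlong F φ V x x) =
      V x := symmL_coordAlong (FiberBundle.mem_baseSet_trivializationAt' (φ x))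
  rw [mdifferentiableAt_sectionAlong_iff hφ] at hV
  rw [covAlong_apply, mvfderiv_congr_of_eventuallyEq (coordAlong_smul hφ.continuousAt f),
    mvfderiv_smul hf hV, leviCivita_extendField_smul, covAlong_apply]
  simp only [add_apply, smul_apply, ContinuousLinearMap.smulRight_apply, map_add, map_smul, hcoord,
    smul_add]
  abel

theorem covAlong_extendField (hφ : MDiffAt φ x) (w : TangentSpace J (φ x)) :
    covAlong I J φ (fun z ↦ extendField w (φ z)) x =
      leviCivita J N (extendField w) (φ x) ∘L mfderiv I J φ x := by
  ext v
  rw [covAlong_apply, mvfderiv_congr_of_eventuallyEq (coordAlong_extend hφ.continuousAt w),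
    mvfderiv_const, zero_apply, map_zero, zero_add, extendField_apply_self,
    ContinuousLinearMap.comp_apply]

theorem covAlong_comp (hφ : MDiffAt φ x) {W : Π y : N, TangentSpace J y}
    (hW : MDiffAt (T% W) (φ x)) :
    covAlong I J φ (fun z ↦ W (φ z)) x = leviCivita J N W (φ x) ∘L mfderiv I J φ x := by
  have tensorial : TensorialAt J F (fun W : Π y : N, TangentSpace J y ↦
      covAlong I J φ (fun z ↦ W (φ z)) x - leviCivita J N W (φ x) ∘L mfderiv I J φ x) (φ x) :=
    { smul := by
        intro f W hf hW
        ext v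
        have hcov := covAlong_smul hφ (MDifferentiableAt.comp x hf hφ)
          (mdifferentiableAt_sectionAlong_comp hφ hW) v
        simp only [Function.comp_apply, mvfderiv_comp_apply x hf hφ v] at hcov
        simp only [sub_apply, smul_apply, ContinuousLinearMap.comp_apply, Pi.smul_apply',
          leviCivita_smul hf hW, hcov, smul_sub]
        abel
      add := by
        intro W W' hW hW'
        have hcov := covAlong_add hφ (mdifferentiableAt_sectionAlong_comp hφ hW)
          (mdifferentiableAt_sectionAlong_comp hφ hW')
        simp only [leviCivita_add hW hW', ContinuousLinearMap.add_comp]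
        refine (congrArg₂ (· - ·) hcov rfl).trans ?_
        abel }
  have h := tensorial.pointwise hW (mdifferentiableAt_extendField (W (φ x)))
    (extendField_apply_self _).symm
  simp only [covAlong_extendField hφ, sub_self] at h
  exact sub_eq_zero.1 h

theorem mvfderiv_inner_comp (hφ : MDiffAt φ x) {W W' : Π y : N, TangentSpace J y}
    (hW : MDiffAt (T% W) (φ x)) (hW' : MDiffAt (T% W') (φ x)) (v : TangentSpace I x) :
    mvfderiv I (fun z ↦ inner ℝ (W (φ z)) (W' (φ z))) x v =
      inner ℝ (covAlong I J φ (fun z ↦ W (φ z)) x v) (W' (φ x)) +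
        inner ℝ (W (φ x)) (covAlong I J φ (fun z ↦ W' (φ z)) x v) := by
  have h := mvfderiv_comp_apply x (mdiffAt_inner hW hW') hφ v
  rw [mvfderiv_inner hW hW'] at h
  rw [covAlong_comp hφ hW, covAlong_comp hφ hW']
  exact h

theorem mvfderiv_inner_along_of_comp (hφ : CMDiffAt 1 φ x)
    (hV' : CMDiffAt 1 (sectionAlong F φ V') x) (v : TangentSpace I x)
    (comp : ∀ {W : Π y : N, TangentSpace J y}, CMDiffAt 1 (T% W) (φ x) →
      mvfderiv I (fun z ↦ inner ℝ (W (φ z)) (V' z)) x v =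
        inner ℝ (covAlong I J φ (fun z ↦ W (φ z)) x v) (V' x) +
          inner ℝ (W (φ x)) (covAlong I J φ V' x v))
    (hV : CMDiffAt 1 (sectionAlong F φ V) x) :
    mvfderiv I (fun z ↦ inner ℝ (V z) (V' z)) x v =
      inner ℝ (covAlong I J φ V x v) (V' x) + inner ℝ (V x) (covAlong I J φ V' x v) := by
  have hφ' : MDiffAt φ x := hφ.mdifferentiableAt one_ne_zero
  have hVd' := hV'.mdifferentiableAt one_ne_zero
  refine contMDiffAt_sectionAlong_induction (𝕜 := ℝ) (P := fun V ↦
    mvfderiv I (fun z ↦ inner ℝ (V z) (V' z)) x v =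
      inner ℝ (covAlong I J φ V x v) (V' x) + inner ℝ (V x) (covAlong I J φ V' x v))
    hφ ?_ comp ?_ ?_ hV
  · intro s s' h hs
    have hinner : (fun z ↦ inner ℝ (s z) (V' z)) =ᶠ[𝓝 x] fun z ↦ inner ℝ (s' z) (V' z) :=
      h.mono fun z hz ↦ by simp only [hz]
    simpa only [mvfderiv_congr_of_eventuallyEq hinner, covAlong_congr h, h.self_of_nhds] using hs
  · intro f s hf hs h
    have hfd := hf.mdifferentiableAt one_ne_zero
    have hsd := hs.mdifferentiableAt one_ne_zero
    have hmul := mvfderiv_fun_mul hfd (mdifferentiableAt_inner_along hsd hVd')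
    simp only [covAlong_smul hφ' hfd hsd, real_inner_smul_left, hmul, inner_add_left, add_apply,
      smul_apply, smul_eq_mul, h]
    ring
  · intro s s' hs hs' h h'
    have hsd := hs.mdifferentiableAt one_ne_zero
    have hsd' := hs'.mdifferentiableAt one_ne_zero
    have hadd := mvfderiv_fun_add (mdifferentiableAt_inner_along hsd hVd')
      (mdifferentiableAt_inner_along hsd' hVd')
    simp only [covAlong_add hφ' hsd hsd', Pi.add_apply, hadd, inner_add_left, add_apply, h, h']
    ring

theorem mvfderiv_inner_along (hφ : CMDiffAt 1 φ x) (hV : CMDiffAt 1 (sectionAlong F φ V) x)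
    (hV' : CMDiffAt 1 (sectionAlong F φ V') x) (v : TangentSpace I x) :
    mvfderiv I (fun z ↦ inner ℝ (V z) (V' z)) x v =
      inner ℝ (covAlong I J φ V x v) (V' x) + inner ℝ (V x) (covAlong I J φ V' x v) := by
  have hφ' : MDiffAt φ x := hφ.mdifferentiableAt one_ne_zero
  refine mvfderiv_inner_along_of_comp hφ hV' v (fun {W} hW ↦ ?_) hV
  have h := mvfderiv_inner_along_of_comp hφ (contMDiffAt_sectionAlong_comp hφ hW) v
    (fun {W'} hW' ↦ mvfderiv_inner_comp hφ' (hW'.mdifferentiableAt one_ne_zero)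
      (hW.mdifferentiableAt one_ne_zero) v) hV'
  simp only [real_inner_comm] at h ⊢
  rw [h, add_comm]

theorem contMDiffAt_leviCivita_along {W : Π y : N, TangentSpace J y}
    (hφ : CMDiffAt ∞ φ x) (hW : CMDiffAt ∞ (T% W) (φ x)) (hV : CMDiffAt ∞ (sectionAlong F φ V) x) :
    CMDiffAt ∞ (sectionAlong F φ fun z ↦ leviCivita J N W (φ z) (V z)) x := by
  refine contMDiffAt_sectionAlong_induction (𝕜 := ℝ)
    (P := fun V ↦ CMDiffAt ∞ (sectionAlong F φ fun z ↦ leviCivita J N W (φ z) (V z)) x)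
    hφ ?_ ?_ ?_ ?_ hV
  · intro s s' h hs
    exact hs.congr_of_eventuallyEq (h.mono fun z hz ↦ by simp only [sectionAlong, hz])
  · intro U hU
    exact contMDiffAt_sectionAlong_comp hφ (contMDiffAt_leviCivita hU hW)
  · intro f s hf _ h
    simpa only [map_smul] using contMDiffAt_sectionAlong_smul hφ hf h
  · intro s s' _ _ h h'
    simp only [Pi.add_apply, map_add]
    exact contMDiffAt_sectionAlong_add (𝕜 := ℝ) hφ h h'

theorem contMDiffAt_covAlong [IsManifold I ∞ M] {X : Π z : M, TangentSpace I z}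
    (hφ : CMDiffAt ∞ φ x) (hX : CMDiffAt ∞ (T% X) x) (hV : CMDiffAt ∞ (sectionAlong F φ V) x) :
    CMDiffAt ∞ (sectionAlong F φ fun z ↦ covAlong I J φ V z (X z)) x := by
  have hφ' := eventually_mdifferentiableAt hφ
  refine contMDiffAt_sectionAlong_induction (𝕜 := ℝ)
    (P := fun V ↦ CMDiffAt ∞ (sectionAlong F φ fun z ↦ covAlong I J φ V z (X z)) x)
    hφ ?_ ?_ ?_ ?_ hV
  · intro s s' h hs
    refine hs.congr_of_eventuallyEq (h.eventually_nhds.mono fun z hz ↦ ?_)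
    simp only [sectionAlong, covAlong_congr hz]
  · intro W hW
    refine (contMDiffAt_leviCivita_along hφ hW
      (contMDiffAt_mfderiv_apply hφ hX)).congr_of_eventuallyEq ?_
    filter_upwards [hφ', hφ.continuousAt.eventually (eventually_mdifferentiableAt hW)]
      with z hφz hWz
    simp only [sectionAlong, covAlong_comp hφz hWz, ContinuousLinearMap.comp_apply]
  · intro f s hf hs h
    refine (contMDiffAt_sectionAlong_add (𝕜 := ℝ) hφ (contMDiffAt_sectionAlong_smul hφ hf h)
      (contMDiffAt_sectionAlong_smul hφ (contMDiffAt_mvfderiv_apply hf hX)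
        hs)).congr_of_eventuallyEq ?_
    filter_upwards [hφ', eventually_mdifferentiableAt hf, eventually_mdifferentiableAt hs]
      with z hφz hfz hsz
    simp only [sectionAlong, covAlong_smul hφz hfz hsz, Pi.add_apply]
  · intro s s' hs hs' h h'
    refine (contMDiffAt_sectionAlong_add (𝕜 := ℝ) hφ h h').congr_of_eventuallyEq ?_
    filter_upwards [hφ', eventually_mdifferentiableAt hs, eventually_mdifferentiableAt hs']
      with z hφz hsz hsz'
    simp only [sectionAlong, covAlong_add hφz hsz hsz', Pi.add_apply, add_apply]

end CovAlong

section SecondFundamentalForm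

variable {E : Type*} [NormedAddCommGroup E] [NormedSpace ℝ E]
  {H : Type*} [TopologicalSpace H] {I : ModelWithCorners ℝ E H}
  {M : Type*} [TopologicalSpace M] [ChartedSpace H M] [IsManifold I ∞ M]
  {F : Type*} [NormedAddCommGroup F] [NormedSpace ℝ F]
  {G : Type*} [TopologicalSpace G] {J : ModelWithCorners ℝ F G}
  {N : Type*} [TopologicalSpace N] [ChartedSpace G N] [IsManifold J ∞ N]
  {φ : M → N} {x : M}

theorem mdifferentiableAt_mfderiv_apply {X : Π z : M, TangentSpace I z} (hφ : CMDiffAt ∞ φ x)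
    (hX : MDiffAt (T% X) x) : MDiffAt (sectionAlong F φ fun z ↦ mfderiv I J φ z (X z)) x :=
  MDifferentiableAt.clm_apply_of_inCoordinates
    ((hφ.mfderiv_const (m := 1)
      (by norm_num; exact ENat.LEInfty.out)).mdifferentiableAt one_ne_zero)
    hX (hφ.mdifferentiableAt (by simp))

theorem coordAlong_mfderiv_extendField (hφ : CMDiffAt ∞ φ x) (w : TangentSpace I x) :
    coordAlong F φ (fun z ↦ mfderiv I J φ z (extendField w z)) x =ᶠ[𝓝 x]
      fun z ↦ mvfderiv I (extChartAt J (φ x) ∘ φ) z (extendField w z) := by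
  filter_upwards [eventually_mdifferentiableAt hφ,
    hφ.continuousAt.eventually ((chartAt G (φ x)).open_source.mem_nhds (mem_chart_source G _))]
    with z hz hzs
  rw [coordAlong, trivializationAt_snd_eq_mvfderiv hzs]
  exact (mfderiv_comp_apply z (mdifferentiableAt_extChartAt hzs) hz (extendField w z)).symm

variable [FiniteDimensional ℝ F] [RiemannianBundle (fun y : N ↦ TangentSpace J y)]
  [IsContMDiffRiemannianBundle J ∞ F (fun y : N ↦ TangentSpace J y)]

theorem leviCivita_extendField_comm {y : N} (u v : TangentSpace J y) :
    leviCivita J N (extendField v) y u = leviCivita J N (extendField u) y v := by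
  rw [← covExtend_apply_self, ← covExtend_apply_self, (covExtend_comm u v).self_of_nhds]

variable [FiniteDimensional ℝ E] [RiemannianBundle (fun x : M ↦ TangentSpace I x)]
  [IsContMDiffRiemannianBundle I ∞ E (fun x : M ↦ TangentSpace I x)]

theorem tensorialAt_secondFundamentalForm (hφ : CMDiffAt ∞ φ x) :
    TensorialAt I E (fun Y : Π z : M, TangentSpace I z ↦
      covAlong I J φ (fun z ↦ mfderiv I J φ z (Y z)) x -
        mfderiv I J φ x ∘L leviCivita I M Y x) x where
  smul := by
    intro f Y hf hY
    ext v
    have hcov := covAlong_smul (hφ.mdifferentiableAt (by simp)) hf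
      (mdifferentiableAt_mfderiv_apply hφ hY) v
    simp only [sub_apply, smul_apply, ContinuousLinearMap.comp_apply, Pi.smul_apply', map_smul,
      leviCivita_smul hf hY v, hcov, map_add, smul_sub]
    abel
  add := by
    intro Y Y' hY hY'
    have hcov := covAlong_add (hφ.mdifferentiableAt (by simp))
      (mdifferentiableAt_mfderiv_apply hφ hY) (mdifferentiableAt_mfderiv_apply hφ hY')
    have hadd : (fun z ↦ mfderiv I J φ z ((Y + Y') z)) =
        (fun z ↦ mfderiv I J φ z (Y z)) + fun z ↦ mfderiv I J φ z (Y' z) :=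
      funext fun z ↦ map_add _ _ _
    rw [hadd, hcov, leviCivita_add hY hY', ContinuousLinearMap.comp_add]
    abel

theorem secondFundamentalForm_eq {Y : Π z : M, TangentSpace I z} (hφ : CMDiffAt ∞ φ x)
    (hY : MDiffAt (T% Y) x) (u : TangentSpace I x) :
    secondFundamentalForm I J φ x u (Y x) =
      covAlong I J φ (fun z ↦ mfderiv I J φ z (Y z)) x u -
        mfderiv I J φ x (leviCivita I M Y x u) :=
  congr($((tensorialAt_secondFundamentalForm hφ).pointwise
    (mdifferentiableAt_extendField (Y x)) hY (extendField_apply_self _)) u)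

theorem contMDiffAt_secondFundamentalForm {X Y : Π z : M, TangentSpace I z} (hφ : CMDiff ∞ φ)
    (hX : CMDiffAt ∞ (T% X) x) (hY : CMDiffAt ∞ (T% Y) x) :
    CMDiffAt ∞ (sectionAlong F φ fun z ↦ secondFundamentalForm I J φ z (X z) (Y z)) x := by
  have hcov := contMDiffAt_covAlong (hφ x) hX (contMDiffAt_mfderiv_apply (hφ x) hY)
  have hneg := contMDiffAt_sectionAlong_smul (hφ x) (f := fun _ ↦ (-1 : ℝ)) contMDiffAt_const
    (contMDiffAt_mfderiv_apply (hφ x) (contMDiffAt_leviCivita hX hY))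
  refine (contMDiffAt_sectionAlong_add (𝕜 := ℝ) (hφ x) hcov hneg).congr_of_eventuallyEq ?_
  filter_upwards [eventually_mdifferentiableAt hY] with z hYz
  simp only [sectionAlong, secondFundamentalForm_eq (hφ z) hYz, Pi.add_apply, neg_one_smul,
    sub_eq_add_neg]

theorem secondFundamentalForm_add_left (u u' v : TangentSpace I x) :
    secondFundamentalForm I J φ x (u + u') v =
      secondFundamentalForm I J φ x u v + secondFundamentalForm I J φ x u' v := by
  simp only [secondFundamentalForm, map_add]
  abel

theorem secondFundamentalForm_smul_left (a : ℝ) (u v : TangentSpace I x) :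
    secondFundamentalForm I J φ x (a • u) v = a • secondFundamentalForm I J φ x u v := by
  simp only [secondFundamentalForm, map_smul, smul_sub]

theorem secondFundamentalForm_eq_coord (hφ : CMDiffAt ∞ φ x) (u v : TangentSpace I x) :
    secondFundamentalForm I J φ x u v =
      (trivializationAt F (TangentSpace J) (φ x)).symmL ℝ (φ x)
          (mvfderiv I (fun z ↦ mvfderiv I (extChartAt J (φ x) ∘ φ) z (extendField v z)) x u) +
        leviCivita J N (extendField (mfderiv I J φ x v)) (φ x) (mfderiv I J φ x u) -
        mfderiv I J φ x (leviCivita I M (extendField v) x u) := by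
  simp only [secondFundamentalForm, covAlong_apply, FiberBundle.extend_apply_self,
    mvfderiv_congr_of_eventuallyEq (coordAlong_mfderiv_extendField hφ v)]

theorem secondFundamentalForm_comm (hφ : CMDiffAt ∞ φ x) (u v : TangentSpace I x) :
    secondFundamentalForm I J φ x u v = secondFundamentalForm I J φ x v u := by
  have hcoord : CMDiffAt ∞ (extChartAt J (φ x) ∘ φ) x :=
    (contMDiffAt_extChartAt (x := φ x)).comp x hφ
  rw [secondFundamentalForm_eq_coord hφ, secondFundamentalForm_eq_coord hφ,
    mvfderiv_mvfderiv_extend_comm hcoord, leviCivita_extendField_comm u v,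
    leviCivita_extendField_comm (mfderiv I J φ x u)]

theorem secondFundamentalForm_add_right (hφ : CMDiffAt ∞ φ x) (u v v' : TangentSpace I x) :
    secondFundamentalForm I J φ x u (v + v') =
      secondFundamentalForm I J φ x u v + secondFundamentalForm I J φ x u v' := by
  simp only [secondFundamentalForm_comm hφ u, secondFundamentalForm_add_left]

theorem secondFundamentalForm_smul_right (hφ : CMDiffAt ∞ φ x) (a : ℝ) (u v : TangentSpace I x) :
    secondFundamentalForm I J φ x u (a • v) = a • secondFundamentalForm I J φ x u v := by
  simp only [secondFundamentalForm_comm hφ u, secondFundamentalForm_smul_left]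

theorem tension_eq_sum (hφ : CMDiffAt ∞ φ x) {ι : Type*} [Fintype ι]
    (e : OrthonormalBasis ι ℝ (TangentSpace I x)) :
    tension I J φ x = ∑ i, secondFundamentalForm I J φ x (e i) (e i) :=
  sum_orthonormalBasis_eq (LinearMap.mk₂ ℝ (secondFundamentalForm I J φ x)
    secondFundamentalForm_add_left secondFundamentalForm_smul_left
    (secondFundamentalForm_add_right hφ) (secondFundamentalForm_smul_right hφ)) _ e

theorem contMDiffAt_tension (hφ : CMDiff ∞ φ) :
    CMDiffAt ∞ (sectionAlong F φ (tension I J φ)) x := by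
  obtain ⟨e, he, hframe⟩ :=
    exists_contMDiffAt_orthonormalBasis I ∞ E (fun x : M ↦ TangentSpace I x) x
  refine (contMDiffAt_sectionAlong_sum (𝕜 := ℝ) (hφ x) Finset.univ fun i _ ↦
    contMDiffAt_secondFundamentalForm hφ (he i) (he i)).congr_of_eventuallyEq ?_
  filter_upwards [hframe] with z ⟨b, hb⟩
  simp only [sectionAlong, tension_eq_sum (hφ z) b, hb, Finset.sum_apply]

end SecondFundamentalForm

section IsometricImmersion

variable {E : Type*} [NormedAddCommGroup E] [NormedSpace ℝ E] [FiniteDimensional ℝ E]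
  {H : Type*} [TopologicalSpace H] {I : ModelWithCorners ℝ E H}
  {M : Type*} [TopologicalSpace M] [ChartedSpace H M] [IsManifold I ∞ M]
  [RiemannianBundle (fun x : M ↦ TangentSpace I x)]
  [IsContMDiffRiemannianBundle I ∞ E (fun x : M ↦ TangentSpace I x)]
  {F : Type*} [NormedAddCommGroup F] [NormedSpace ℝ F] [FiniteDimensional ℝ F]
  {G : Type*} [TopologicalSpace G] {J : ModelWithCorners ℝ F G}
  {N : Type*} [TopologicalSpace N] [ChartedSpace G N] [IsManifold J ∞ N]
  [RiemannianBundle (fun y : N ↦ TangentSpace J y)]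
  [IsContMDiffRiemannianBundle J ∞ F (fun y : N ↦ TangentSpace J y)]
  {φ : M → N} {x : M} {c : ℝ}

theorem IsIsometricImmersion.inner_secondFundamentalForm_swap (hφ : IsIsometricImmersion I J φ)
    (u v w : TangentSpace I x) :
    inner ℝ (secondFundamentalForm I J φ x u v) (mfderiv I J φ x w) =
      -inner ℝ (secondFundamentalForm I J φ x u w) (mfderiv I J φ x v) := by
  have hφx := hφ.smooth x
  have hdφ (w : TangentSpace I x) :=
    (contMDiffAt_mfderiv_apply hφx (contMDiffAt_extendField w)).of_le (m := 1) (by simp)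
  have h := mvfderiv_inner_along (hφx.of_le (by simp)) (hdφ v) (hdφ w) u
  simp only [hφ.inner_eq] at h
  rw [mvfderiv_inner (mdifferentiableAt_extendField v) (mdifferentiableAt_extendField w),
    ← hφ.inner_eq, ← hφ.inner_eq] at h
  simp only [extendField_apply_self] at h
  simp only [secondFundamentalForm, inner_sub_left]
  rw [real_inner_comm _ (mfderiv I J φ x v), real_inner_comm _ (mfderiv I J φ x v)] at h
  linarith

theorem IsIsometricImmersion.inner_secondFundamentalForm (hφ : IsIsometricImmersion I J φ)
    (u v w : TangentSpace I x) :
    inner ℝ (secondFundamentalForm I J φ x u v) (mfderiv I J φ x w) = 0 := by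
  have comm := secondFundamentalForm_comm (hφ.smooth x)
  have huvw := hφ.inner_secondFundamentalForm_swap u v w
  have hvwu := hφ.inner_secondFundamentalForm_swap v w u
  have hwuv := hφ.inner_secondFundamentalForm_swap w u v
  rw [comm v u] at hvwu
  rw [comm w u, comm w v] at hwuv
  linarith

theorem IsIsometricImmersion.inner_tension (hφ : IsIsometricImmersion I J φ)
    (w : TangentSpace I x) : inner ℝ (tension I J φ x) (mfderiv I J φ x w) = 0 := by
  simp only [tension, sum_inner, hφ.inner_secondFundamentalForm, Finset.sum_const_zero]

theorem IsIsometricImmersion.inner_covAlong_tension (hφ : IsIsometricImmersion I J φ)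
    (u v : TangentSpace I x) :
    inner ℝ (covAlong I J φ (tension I J φ) x u) (mfderiv I J φ x v) =
      -inner ℝ (tension I J φ x) (secondFundamentalForm I J φ x u v) := by
  have hφx := hφ.smooth x
  have h := mvfderiv_inner_along (hφx.of_le (by simp))
    ((contMDiffAt_tension hφ.smooth).of_le (by simp))
    ((contMDiffAt_mfderiv_apply hφx (contMDiffAt_extendField v)).of_le (by simp)) u
  simp only [hφ.inner_tension, mvfderiv_const, zero_apply, extendField_apply_self] at h
  simp only [secondFundamentalForm, inner_sub_right, hφ.inner_tension]
  linarith

theorem IsIsometricImmersion.sum_curvature_covAlong_tension (hφ : IsIsometricImmersion I J φ)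
    (hN : HasConstantCurvature J N c) {ι : Type*} [Fintype ι]
    (e : OrthonormalBasis ι ℝ (TangentSpace I x)) :
    ∑ i, curvature J (covAlong I J φ (tension I J φ) x (e i)) (tension I J φ x)
        (mfderiv I J φ x (e i)) =
      (c * inner ℝ (tension I J φ x) (tension I J φ x)) • tension I J φ x := by
  have hcurv (i : ι) : curvature J (covAlong I J φ (tension I J φ) x (e i)) (tension I J φ x)
      (mfderiv I J φ x (e i)) =
        (c * inner ℝ (tension I J φ x) (secondFundamentalForm I J φ x (e i) (e i))) •
          tension I J φ x := by
    rw [hN.curvature_eq, hφ.inner_tension, hφ.inner_covAlong_tension, zero_smul, zero_sub,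
      neg_smul, neg_neg, smul_smul]
  simp only [hcurv]
  rw [← Finset.sum_smul, ← Finset.mul_sum, ← inner_sum, ← tension_eq_sum (hφ.smooth x) e]

end IsometricImmersion

end RiemGeom

theorem corollary2p3_general
    {E : Type*} [NormedAddCommGroup E] [NormedSpace ℝ E] [FiniteDimensional ℝ E]
    {H : Type*} [TopologicalSpace H] (I : ModelWithCorners ℝ E H)
    {M : Type*} [TopologicalSpace M] [ChartedSpace H M] [IsManifold I ∞ M]
    [RiemannianBundle (fun x : M ↦ TangentSpace I x)]
    [IsContMDiffRiemannianBundle I ∞ E (fun x : M ↦ TangentSpace I x)]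
    {F : Type*} [NormedAddCommGroup F] [NormedSpace ℝ F] [FiniteDimensional ℝ F]
    {G : Type*} [TopologicalSpace G] (J : ModelWithCorners ℝ F G)
    {N : Type*} [TopologicalSpace N] [ChartedSpace G N] [IsManifold J ∞ N]
    [RiemannianBundle (fun y : N ↦ TangentSpace J y)]
    [IsContMDiffRiemannianBundle J ∞ F (fun y : N ↦ TangentSpace J y)]
    (c : ℝ) (hN : HasConstantCurvature J N c)
    (φ : M → N) (hφ : IsIsometricImmersion I J φ)
    (x : M) {ι : Type*} [Fintype ι] (e : OrthonormalBasis ι ℝ (TangentSpace I x)) :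
    tritension I J φ x =
      roughLaplacian I J φ (roughLaplacian I J φ (tension I J φ)) x
        - ∑ j, curvature J (roughLaplacian I J φ (tension I J φ) x)
            (mfderiv I J φ x (e j)) (mfderiv I J φ x (e j))
        - (c * inner ℝ (tension I J φ x) (tension I J φ x)) • tension I J φ x := by
  have hR := hφ.sum_curvature_covAlong_tension hN (stdOrthonormalBasis ℝ (TangentSpace I x))
  have htrace := sum_curvature_eq (mfderiv I J φ x).toLinearMap
    (roughLaplacian I J φ (tension I J φ) x) e (stdOrthonormalBasis ℝ (TangentSpace I x))
  exact congrArg₂ (· - ·) (congrArg _ htrace.symm) hR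

theorem corollary2p3
    {E : Type*} [NormedAddCommGroup E] [NormedSpace ℝ E] [FiniteDimensional ℝ E]
    {H : Type*} [TopologicalSpace H] (I : ModelWithCorners ℝ E H) [I.Boundaryless]
    {M : Type*} [TopologicalSpace M] [ChartedSpace H M] [IsManifold I ∞ M]
    [RiemannianBundle (fun x : M ↦ TangentSpace I x)]
    [IsContMDiffRiemannianBundle I ∞ E (fun x : M ↦ TangentSpace I x)]
    {F : Type*} [NormedAddCommGroup F] [NormedSpace ℝ F] [FiniteDimensional ℝ F]
    {G : Type*} [TopologicalSpace G] (J : ModelWithCorners ℝ F G) [J.Boundaryless]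
    {N : Type*} [TopologicalSpace N] [ChartedSpace G N] [IsManifold J ∞ N]
    [RiemannianBundle (fun y : N ↦ TangentSpace J y)]
    [IsContMDiffRiemannianBundle J ∞ F (fun y : N ↦ TangentSpace J y)]
    (c : ℝ) (hN : HasConstantCurvature J N c)
    (φ : M → N) (hφ : IsIsometricImmersion I J φ)
    (x : M) {ι : Type*} [Fintype ι] (e : OrthonormalBasis ι ℝ (TangentSpace I x)) :
    tritension I J φ x =
      roughLaplacian I J φ (roughLaplacian I J φ (tension I J φ)) x
        - ∑ j, curvature J (roughLaplacian I J φ (tension I J φ) x)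
            (mfderiv I J φ x (e j)) (mfderiv I J φ x (e j))
        - (c * inner ℝ (tension I J φ x) (tension I J φ x)) • tension I J φ x :=
  corollary2p3_general I J c hN φ hφ x e
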